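/- For a $C^*$-algebra $D$ write $\mathrm{Cu}(D)$ for its Cuntz semigroup: the set of classes $\langle a\rangle$ of positive elements $a\in D\otimes\mathcal K$ under Cuntz equivalence, where $\langle a\rangle\le\langle b\rangle$ if and only if there are $d_k\in D\otimes\mathcal K$ with $d_k b d_k^*\to a$, and $\langle a\rangle+\langle b\rangle=\langle a\oplus b\rangle$ (with $M_2(\mathcal K)\cong\mathcal K$). For $u',u\in\mathrm{Cu}(D)$ write $u'\ll u$ if, whenever $u$ is the supremum of an increasing sequence $(u_i)$ in $\mathrm{Cu}(D)$, one has $u'\le u_i$ for some $i$. Let $m,n\ge 1$ be integers. An element $u\in \mathrm{Cu}(D)$ is called * *$(m,n)$-divisible* if for every $u'\ll u$ there is $x\in\mathrm{Cu}(D)$ with $mx\le u$ and $u'\le nx$; * *$(m,n)$-decomposable* if for every $u'\ll u$ there are $x_1,\dots,x_m\in\mathrm{Cu}(D)$ with $x_1+\cdots+x_m\le u$ and $u'\le nx_j$ for $j=1,\dots,m$; * *weakly $(m,n)$-divisible* if for every $u'\ll u$ there are $x_1,\dots,x_n\in\mathrm{Cu}(D)$ with $mx_j\le u$ for $j=1,\dots,n$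 and $u'\le x_1+\cdots+x_n$. A unital $C^*$-algebra $D$ is said to have one of these properties if $u=\langle 1_D\rangle$ has it. For $C^*$-algebras $A,B$ let $A\otimes B$ be the minimal (spatial) tensor product and let $\mathrm{Cu}(A)\times\mathrm{Cu}(B)\to\mathrm{Cu}(A\otimes B)$, $(x,y)\mapsto x\otimes y$, be the map given by $\langle a\rangle\otimes\langle b\rangle=\langle a\otimes b\rangle$, where $(A\otimes\mathcal K)\otimes(B\otimes\mathcal K)$ is identified with $(A\otimes B)\otimes\mathcal K$. **Lemma.** Let $A$ and $B$ be unital $C^*$-algebras and let $1\le m<n$ be integers. (i) Let $x,y\in\mathrm{Cu}(A)$ be such that $nx\le my$. If $B$ is $(m,n)$-divisible, then $x\otimes\langle 1_B\rangle\le y\otimes\langle 1_B\rangle$. (ii) Let $x_1,\dots,x_m,y\in\mathrm{Cu}(A)$ be such that $nx_j\le y$ for all $j$. If $B$ is $(m,n)$-decomposable, then $(x_1+\cdots+x_m)\otimes\langle 1_B\rangle\le y\otimes\langle 1_B\rangle$. (iii) Let $x,y_1,\dots,y_n\in\mathrm{Cu}(A)$ be such that $x\le my_j$ for all $j$. If $B$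 is weakly $(m,n)$-divisible, then $x\otimes\langle 1_B\rangle\le(y_1+\cdots+y_n)\otimes\langle 1_B\rangle$. -/

import Mathlib

open scoped TensorProduct

universe u v

noncomputable section

namespace CuntzDiv

section UniversalRepresentation

open scoped ComplexOrder ENNReal

variable (A : Type u) [CStarAlgebra A]

/-- The positive linear functionals on `A`, for the usual order of a C*-algebra. -/
abbrev PosFunctional : Type u :=
  @PositiveLinearMap ℂ A ℂ _ _ (CStarAlgebra.spectralOrder A) _ _ _ _

variable {A}

/-- The GNS Hilbert space of a positive functional. -/
def gnsSpace (φ : PosFunctional A) : Type u :=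
  letI := CStarAlgebra.spectralOrder A
  letI := CStarAlgebra.spectralOrderedRing A
  PositiveLinearMap.GNS φ

instance (φ : PosFunctional A) : NormedAddCommGroup (gnsSpace φ) :=
  letI := CStarAlgebra.spectralOrder A
  letI := CStarAlgebra.spectralOrderedRing A
  (inferInstance : NormedAddCommGroup (PositiveLinearMap.GNS φ))

instance (φ : PosFunctional A) : InnerProductSpace ℂ (gnsSpace φ) :=
  letI := CStarAlgebra.spectralOrder A
  letI := CStarAlgebra.spectralOrderedRing A
  (inferInstance : InnerProductSpace ℂ (PositiveLinearMap.GNS φ))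

instance (φ : PosFunctional A) : CompleteSpace (gnsSpace φ) :=
  letI := CStarAlgebra.spectralOrder A
  letI := CStarAlgebra.spectralOrderedRing A
  (inferInstance : CompleteSpace (PositiveLinearMap.GNS φ))

/-- The GNS representation of a positive functional. -/
def gnsRep (φ : PosFunctional A) : A →⋆ₐ[ℂ] (gnsSpace φ →L[ℂ] gnsSpace φ) :=
  letI := CStarAlgebra.spectralOrder A
  letI := CStarAlgebra.spectralOrderedRing A
  PositiveLinearMap.gnsStarAlgHom φ

theorem norm_gnsRep_le (φ : PosFunctional A) (a : A) : ‖gnsRep φ a‖ ≤ ‖a‖ :=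
  NonUnitalStarAlgHom.norm_apply_le (gnsRep φ) a

variable (A) in
/-- The Hilbert space of the universal representation of `A`: the Hilbert sum of all GNS spaces. -/
abbrev UnivSpace : Type u := lp (fun φ : PosFunctional A => gnsSpace φ) 2

theorem norm_gnsRep_apply_le (φ : PosFunctional A) (a : A) (x : gnsSpace φ) :
    ‖gnsRep φ a x‖ ≤ ‖a‖ * ‖x‖ :=
  ((gnsRep φ a).le_opNorm x).trans
    (mul_le_mul_of_nonneg_right (norm_gnsRep_le φ a) (norm_nonneg x))

theorem memlp_gnsRep (a : A) (ξ : UnivSpace A) :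
    Memℓp (fun φ => gnsRep φ a (ξ φ)) 2 := by
  refine Memℓp.mono ((lp.memℓp ξ).norm.const_smul ‖a‖) fun φ => ?_
  exact norm_gnsRep_apply_le φ a (ξ φ)

/-- The operator by which `a` acts in the universal representation. -/
def univRepOp (a : A) : UnivSpace A →L[ℂ] UnivSpace A :=
  LinearMap.mkContinuous
    { toFun := fun ξ => ⟨fun φ => gnsRep φ a (ξ φ), memlp_gnsRep a ξ⟩
      map_add' := fun ξ η => by ext φ; exact map_add (gnsRep φ a) (ξ φ) (η φ)
      map_smul' := fun c ξ => by ext φ; exact map_smul (gnsRep φ a) c (ξ φ) }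
    ‖a‖ (fun ξ => by
      have h : ‖(⟨fun φ => gnsRep φ a (ξ φ), memlp_gnsRep a ξ⟩ : UnivSpace A)‖
          ≤ ‖(‖a‖ : ℂ) • ξ‖ := by
        refine lp.norm_mono (by norm_num) fun φ => ?_
        have h2 : ‖((‖a‖ : ℂ) • ξ) φ‖ = ‖a‖ * ‖ξ φ‖ := by
          rw [lp.coeFn_smul, Pi.smul_apply, norm_smul, Complex.norm_real, norm_norm]
        rw [h2]
        exact norm_gnsRep_apply_le φ a (ξ φ)
      rwa [norm_smul, Complex.norm_real, norm_norm] at h)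

@[simp]
theorem univRepOp_apply (a : A) (ξ : UnivSpace A) (φ : PosFunctional A) :
    univRepOp a ξ φ = gnsRep φ a (ξ φ) := rfl

variable (A) in
/-- The universal representation of `A`: the direct sum of all GNS representations. -/
def univRep : A →⋆ₐ[ℂ] (UnivSpace A →L[ℂ] UnivSpace A) where
  toFun := univRepOp
  map_one' := by ext ξ φ; simp
  map_mul' a b := by ext ξ φ; simp
  map_zero' := by ext ξ φ; simp
  map_add' a b := by ext ξ φ; simp
  commutes' r := by ext ξ φ; simp [Algebra.algebraMap_eq_smul_one]
  map_star' a := by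
    rw [ContinuousLinearMap.star_eq_adjoint, ContinuousLinearMap.eq_adjoint_iff]
    intro ξ η
    rw [lp.inner_eq_tsum, lp.inner_eq_tsum]
    refine tsum_congr fun φ => ?_
    simp [map_star, ContinuousLinearMap.star_eq_adjoint, ContinuousLinearMap.adjoint_inner_left]

end UniversalRepresentation

section ConcreteAlgebra

variable {H : Type u} [NormedAddCommGroup H] [InnerProductSpace ℂ H] [CompleteSpace H]

/-- The norm-closed unital `*`-algebra of operators generated by a set of bounded operators. -/
def closedStarAlgebra (S : Set (H →L[ℂ] H)) : StarSubalgebra ℂ (H →L[ℂ] H) :=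
  (StarAlgebra.adjoin ℂ S).topologicalClosure

instance (S : Set (H →L[ℂ] H)) : CStarAlgebra (closedStarAlgebra S) :=
  StarSubalgebra.cstarAlgebra (closedStarAlgebra S)
    (h_closed := StarSubalgebra.isClosed_topologicalClosure _)

theorem subset_closedStarAlgebra {S : Set (H →L[ℂ] H)} {T : H →L[ℂ] H} (hT : T ∈ S) :
    T ∈ closedStarAlgebra S :=
  StarSubalgebra.le_topologicalClosure _ (StarAlgebra.subset_adjoin ℂ S hT)

end ConcreteAlgebra

section MinimalTensorProduct

open UniformSpace

variable (A : Type u) (B : Type v) [CStarAlgebra A] [CStarAlgebra B]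

/-- The Hilbert space tensor product of the universal representation spaces. -/
abbrev TensorSpace : Type (max u v) := Completion (UnivSpace A ⊗[ℂ] UnivSpace B)

variable {A B}

/-- The operator `π_A(a) ⊗ π_B(b)`, where `π` is the universal representation. -/
def tensorOp (a : A) (b : B) : TensorSpace A B →L[ℂ] TensorSpace A B :=
  (TensorProduct.mapL (univRep A a) (univRep B b)).completion

theorem clm_ext {E F : Type*} [SeminormedAddCommGroup E] [NormedSpace ℂ E]
    [NormedAddCommGroup F] [NormedSpace ℂ F] {f g : Completion E →L[ℂ] F}
    (h : ∀ x : E, f x = g x) : f = g := by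
  ext x
  induction x using Completion.induction_on with
  | hp => exact isClosed_eq f.continuous g.continuous
  | ih x => exact h x

theorem tensorOp_add_left (a a' : A) (b : B) :
    tensorOp (a + a') b = tensorOp a b + tensorOp a' b := by
  refine clm_ext fun x => ?_
  simp only [tensorOp, map_add, TensorProduct.mapL_add_left, _root_.add_apply,
    ContinuousLinearMap.completion_apply_coe, Completion.coe_add]

theorem tensorOp_add_right (a : A) (b b' : B) :
    tensorOp a (b + b') = tensorOp a b + tensorOp a b' := by
  refine clm_ext fun x => ?_
  simp only [tensorOp, map_add, TensorProduct.mapL_add_right, _root_.add_apply,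
    ContinuousLinearMap.completion_apply_coe, Completion.coe_add]

theorem tensorOp_smul_left (c : ℂ) (a : A) (b : B) :
    tensorOp (c • a) b = c • tensorOp a b := by
  refine clm_ext fun x => ?_
  simp only [tensorOp, map_smul, TensorProduct.mapL_smul_left, _root_.smul_apply,
    ContinuousLinearMap.completion_apply_coe, Completion.coe_smul]

theorem tensorOp_smul_right (c : ℂ) (a : A) (b : B) :
    tensorOp a (c • b) = c • tensorOp a b := by
  refine clm_ext fun x => ?_
  simp only [tensorOp, map_smul, TensorProduct.mapL_smul_right, _root_.smul_apply,
    ContinuousLinearMap.completion_apply_coe, Completion.coe_smul]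

theorem tensorOp_mul (a a' : A) (b b' : B) :
    tensorOp (a * a') (b * b') = tensorOp a b * tensorOp a' b' := by
  refine clm_ext fun x => ?_
  simp only [tensorOp, map_mul, TensorProduct.mapL_mul, mul_apply_eq_comp,
    ContinuousLinearMap.completion_apply_coe]

theorem tensorOp_one : tensorOp (1 : A) (1 : B) = 1 := by
  refine clm_ext fun x => ?_
  simp only [tensorOp, map_one, ContinuousLinearMap.one_def, TensorProduct.mapL_id_id,
    ContinuousLinearMap.completion_apply_coe, ContinuousLinearMap.id_apply]

theorem inner_mapL_left (S : UnivSpace A →L[ℂ] UnivSpace A) (T : UnivSpace B →L[ℂ] UnivSpace B)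
    (x y : UnivSpace A ⊗[ℂ] UnivSpace B) :
    inner ℂ (TensorProduct.mapL (star S) (star T) x) y = inner ℂ x (TensorProduct.mapL S T y) := by
  induction x using TensorProduct.induction_on with
  | zero => simp only [map_zero, inner_zero_left]
  | add x x' hx hx' => simp only [map_add, inner_add_left, hx, hx']
  | tmul p q =>
    induction y using TensorProduct.induction_on with
    | zero => simp only [map_zero, inner_zero_right]
    | add y y' hy hy' => simp only [map_add, inner_add_right, hy, hy']
    | tmul r s =>
      simp only [TensorProduct.mapL_tmul, TensorProduct.inner_tmul,
        ContinuousLinearMap.star_eq_adjoint, ContinuousLinearMap.adjoint_inner_left]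

theorem tensorOp_star (a : A) (b : B) : tensorOp (star a) (star b) = star (tensorOp a b) := by
  rw [ContinuousLinearMap.star_eq_adjoint, ContinuousLinearMap.eq_adjoint_iff]
  intro x y
  induction x, y using Completion.induction_on₂ with
  | hp => apply isClosed_eq <;> fun_prop
  | ih x y =>
    simp only [tensorOp, ContinuousLinearMap.completion_apply_coe, Completion.inner_coe, map_star]
    exact inner_mapL_left _ _ x y

variable (A B) in
/-- The minimal (spatial) tensor product `A ⊗ B` of two unital C*-algebras: the closed
`*`-subalgebra of `B(H_A ⊗ H_B)` generated by the operators `π_A(a) ⊗ π_B(b)`. -/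
def MinTensor : Type (max u v) :=
  closedStarAlgebra {T : TensorSpace A B →L[ℂ] TensorSpace A B |
    ∃ (a : A) (b : B), T = tensorOp a b}

instance : CStarAlgebra (MinTensor A B) :=
  (inferInstance : CStarAlgebra (closedStarAlgebra {T : TensorSpace A B →L[ℂ] TensorSpace A B |
    ∃ (a : A) (b : B), T = tensorOp a b}))

/-- The elementary tensor `a ⊗ b`. -/
def MinTensor.tmul (a : A) (b : B) : MinTensor A B :=
  ⟨tensorOp a b, subset_closedStarAlgebra ⟨a, b, rfl⟩⟩

theorem MinTensor.add_tmul (a a' : A) (b : B) : tmul (a + a') b = tmul a b + tmul a' b :=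
  Subtype.ext (tensorOp_add_left a a' b)

theorem MinTensor.tmul_add (a : A) (b b' : B) : tmul a (b + b') = tmul a b + tmul a b' :=
  Subtype.ext (tensorOp_add_right a b b')

theorem MinTensor.smul_tmul (c : ℂ) (a : A) (b : B) : tmul (c • a) b = c • tmul a b :=
  Subtype.ext (tensorOp_smul_left c a b)

theorem MinTensor.tmul_smul (c : ℂ) (a : A) (b : B) : tmul a (c • b) = c • tmul a b :=
  Subtype.ext (tensorOp_smul_right c a b)

theorem MinTensor.tmul_mul_tmul (a a' : A) (b b' : B) :
    tmul a b * tmul a' b' = tmul (a * a') (b * b') :=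
  Subtype.ext (tensorOp_mul a a' b b').symm

theorem MinTensor.star_tmul (a : A) (b : B) : star (tmul a b) = tmul (star a) (star b) :=
  Subtype.ext (tensorOp_star a b).symm

theorem MinTensor.one_def : (1 : MinTensor A B) = tmul 1 1 :=
  Subtype.ext tensorOp_one.symm

end MinimalTensorProduct
section FiniteMatrices

open Finset

variable (A : Type u) [CStarAlgebra A]

/-- The infinite matrices over `A` that vanish outside some `n × n` corner. -/
def finMatSubmodule : Submodule ℂ (Matrix ℕ ℕ A) where
  carrier := {M | ∃ n : ℕ, ∀ i j, n ≤ i ∨ n ≤ j → M i j = 0}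
  zero_mem' := ⟨0, fun _ _ _ => rfl⟩
  add_mem' := by
    rintro M N ⟨m, hM⟩ ⟨n, hN⟩
    refine ⟨max m n, fun i j h => ?_⟩
    rw [Matrix.add_apply, hM i j (h.imp (le_of_max_le_left) (le_of_max_le_left)),
      hN i j (h.imp (le_of_max_le_right) (le_of_max_le_right)), add_zero]
  smul_mem' := by
    rintro c M ⟨m, hM⟩
    exact ⟨m, fun i j h => by rw [Matrix.smul_apply, hM i j h, smul_zero]⟩

/-- The `*`-algebra `M_∞(A)`, the increasing union of the matrix algebras `M_n(A)`. -/
def FinMat : Type u := finMatSubmodule A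

/-- The matrix algebra `M_n(A)` with its C*-norm (for the usual order of `A`). -/
instance (n : ℕ) : NonUnitalCStarAlgebra (CStarMatrix (Fin n) (Fin n) A) :=
  letI := CStarAlgebra.spectralOrder A
  letI := CStarAlgebra.spectralOrderedRing A
  inferInstance

namespace FinMat

variable {A}

instance : AddCommGroup (FinMat A) := inferInstanceAs (AddCommGroup (finMatSubmodule A))

instance : Module ℂ (FinMat A) := inferInstanceAs (Module ℂ (finMatSubmodule A))

/-- The entries of a matrix in `M_∞(A)`. -/
def entries (M : FinMat A) : ℕ → ℕ → A := M.1

instance : CoeFun (FinMat A) (fun _ => ℕ → ℕ → A) := ⟨entries⟩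

/-- The element of `M_∞(A)` with given entries. -/
def mk (M : ℕ → ℕ → A) (h : ∃ n : ℕ, ∀ i j, n ≤ i ∨ n ≤ j → M i j = 0) : FinMat A := ⟨M, h⟩

theorem mk_apply (M : ℕ → ℕ → A) (h : ∃ n : ℕ, ∀ i j, n ≤ i ∨ n ≤ j → M i j = 0) (i j : ℕ) :
    mk M h i j = M i j := rfl

/-- The matrix `M` vanishes outside the upper left `n × n` corner. -/
def Bdd (n : ℕ) (M : FinMat A) : Prop := ∀ i j, n ≤ i ∨ n ≤ j → M i j = 0

theorem exists_bdd (M : FinMat A) : ∃ n, Bdd n M := M.2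

theorem Bdd.mono {n m : ℕ} {M : FinMat A} (h : Bdd n M) (hnm : n ≤ m) : Bdd m M :=
  fun i j hij => h i j (hij.imp hnm.trans hnm.trans)

theorem exists_bdd₂ (M N : FinMat A) : ∃ n, Bdd n M ∧ Bdd n N := by
  obtain ⟨m, hm⟩ := exists_bdd M
  obtain ⟨n, hn⟩ := exists_bdd N
  exact ⟨max m n, hm.mono (le_max_left _ _), hn.mono (le_max_right _ _)⟩

@[ext]
theorem ext {M N : FinMat A} (h : ∀ i j, M i j = N i j) : M = N :=
  Subtype.ext (funext fun i => funext fun j => h i j)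

@[simp] theorem zero_apply (i j : ℕ) : (0 : FinMat A) i j = 0 := rfl
@[simp] theorem add_apply (M N : FinMat A) (i j : ℕ) : (M + N) i j = M i j + N i j := rfl
@[simp] theorem neg_apply (M : FinMat A) (i j : ℕ) : (-M) i j = -M i j := rfl
@[simp] theorem sub_apply (M N : FinMat A) (i j : ℕ) : (M - N) i j = M i j - N i j := rfl
@[simp] theorem smul_apply (c : ℂ) (M : FinMat A) (i j : ℕ) : (c • M) i j = c • M i j := rfl

theorem Bdd.add {n : ℕ} {M N : FinMat A} (hM : Bdd n M) (hN : Bdd n N) : Bdd n (M + N) :=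
  fun i j h => by rw [add_apply, hM i j h, hN i j h, add_zero]

theorem finsum_mul_eq_left {n : ℕ} {M : FinMat A} (hM : Bdd n M) (N : FinMat A) (i k : ℕ) :
    ∑ᶠ j, M i j * N j k = ∑ j ∈ range n, M i j * N j k := by
  refine finsum_eq_sum_of_support_subset _ fun j hj => ?_
  by_contra hjn
  exact hj (by simp [hM i j (Or.inr (by simpa using hjn))])

theorem finsum_mul_eq_right {n : ℕ} (M : FinMat A) {N : FinMat A} (hN : Bdd n N) (i k : ℕ) :
    ∑ᶠ j, M i j * N j k = ∑ j ∈ range n, M i j * N j k := by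
  refine finsum_eq_sum_of_support_subset _ fun j hj => ?_
  by_contra hjn
  exact hj (by simp [hN j k (Or.inl (by simpa using hjn))])

/-- Matrix multiplication. -/
instance : Mul (FinMat A) where
  mul M N := mk (fun i k => ∑ᶠ j, M i j * N j k) <| by
    obtain ⟨n, hM, hN⟩ := exists_bdd₂ M N
    refine ⟨n, fun i k h => ?_⟩
    show ∑ᶠ j, M i j * N j k = 0
    rw [finsum_mul_eq_left hM]
    refine sum_eq_zero fun j _ => ?_
    rcases h with h | h
    · rw [hM i j (Or.inl h), zero_mul]
    · rw [hN j k (Or.inr h), mul_zero]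

theorem mul_apply_left {n : ℕ} {M : FinMat A} (hM : Bdd n M) (N : FinMat A) (i k : ℕ) :
    (M * N) i k = ∑ j ∈ range n, M i j * N j k := finsum_mul_eq_left hM N i k

theorem mul_apply_right {n : ℕ} (M : FinMat A) {N : FinMat A} (hN : Bdd n N) (i k : ℕ) :
    (M * N) i k = ∑ j ∈ range n, M i j * N j k := finsum_mul_eq_right M hN i k

theorem Bdd.mul {n : ℕ} {M N : FinMat A} (hM : Bdd n M) (hN : Bdd n N) : Bdd n (M * N) := by
  intro i k h
  rw [mul_apply_left hM]
  refine sum_eq_zero fun j _ => ?_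
  rcases h with h | h
  · rw [hM i j (Or.inl h), zero_mul]
  · rw [hN j k (Or.inr h), mul_zero]

instance : NonUnitalRing (FinMat A) where
  left_distrib M N P := by
    obtain ⟨n, hM⟩ := exists_bdd M
    ext i k
    simp only [add_apply, mul_apply_left hM, mul_add, sum_add_distrib]
  right_distrib M N P := by
    obtain ⟨n, hP⟩ := exists_bdd P
    ext i k
    simp only [add_apply, mul_apply_right _ hP, add_mul, sum_add_distrib]
  zero_mul M := by
    obtain ⟨n, hM⟩ := exists_bdd M
    ext i k
    simp [mul_apply_right _ hM]
  mul_zero M := by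
    obtain ⟨n, hM⟩ := exists_bdd M
    ext i k
    simp [mul_apply_left hM]
  mul_assoc M N P := by
    obtain ⟨n, hM, hN⟩ := exists_bdd₂ M N
    ext i l
    rw [mul_apply_left (hM.mul hN), mul_apply_left hM]
    simp only [mul_apply_left hM, mul_apply_left hN, sum_mul, mul_sum, mul_assoc]
    exact sum_comm

instance : IsScalarTower ℂ (FinMat A) (FinMat A) where
  smul_assoc c M N := by
    obtain ⟨n, hN⟩ := exists_bdd N
    ext i k
    simp only [smul_eq_mul, smul_apply, mul_apply_right _ hN, smul_sum, smul_mul_assoc]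

instance : SMulCommClass ℂ (FinMat A) (FinMat A) where
  smul_comm c M N := by
    obtain ⟨n, hM⟩ := exists_bdd M
    ext i k
    simp only [smul_eq_mul, smul_apply, mul_apply_left hM, smul_sum, mul_smul_comm]

theorem bdd_conjTranspose {n : ℕ} {M : FinMat A} (h : Bdd n M) (i j : ℕ)
    (hij : n ≤ i ∨ n ≤ j) : star (M j i) = 0 := by
  rw [h j i hij.symm, star_zero]

/-- The conjugate transpose. -/
instance : Star (FinMat A) where
  star M := mk (fun i j => star (M j i)) ((exists_bdd M).imp fun _ h => bdd_conjTranspose h)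

@[simp] theorem star_apply (M : FinMat A) (i j : ℕ) : (star M) i j = star (M j i) := rfl

theorem Bdd.star {n : ℕ} {M : FinMat A} (h : Bdd n M) : Bdd n (star M) := bdd_conjTranspose h

instance : StarRing (FinMat A) where
  star_involutive M := by ext; simp
  star_mul M N := by
    obtain ⟨n, hM⟩ := exists_bdd M
    ext i k
    simp only [star_apply, mul_apply_left hM, mul_apply_right _ hM.star, star_sum, star_mul]
  star_add M N := by ext; simp

instance : StarModule ℂ (FinMat A) where
  star_smul c M := by ext; simp

/-- The upper left `n × n` corner of an infinite matrix. -/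
def corner (n : ℕ) (M : FinMat A) : CStarMatrix (Fin n) (Fin n) A :=
  CStarMatrix.ofMatrix fun i j => M i j

@[simp] theorem corner_apply (n : ℕ) (M : FinMat A) (i j : Fin n) : corner n M i j = M i j := rfl

/-- The matrix obtained from an `n × n` matrix by adding zeros. -/
def padFun (n : ℕ) (X : CStarMatrix (Fin n) (Fin n) A) : FinMat A :=
  mk (fun i j => if h : i < n ∧ j < n then X ⟨i, h.1⟩ ⟨j, h.2⟩ else 0)
    ⟨n, fun i j h => dif_neg (by omega)⟩

theorem padFun_apply (n : ℕ) (X : CStarMatrix (Fin n) (Fin n) A) (i j : ℕ) :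
    padFun n X i j = if h : i < n ∧ j < n then X ⟨i, h.1⟩ ⟨j, h.2⟩ else 0 := rfl

theorem padFun_bdd (n : ℕ) (X : CStarMatrix (Fin n) (Fin n) A) : Bdd n (padFun n X) :=
  fun i j h => dif_neg (by omega)

/-- The inclusion of `M_n(A)` into `M_∞(A)`. -/
def pad (n : ℕ) : CStarMatrix (Fin n) (Fin n) A →⋆ₙₐ[ℂ] FinMat A where
  toFun := padFun n
  map_smul' c X := by
    ext i j
    by_cases h : i < n ∧ j < n <;> simp [padFun_apply, h]
  map_zero' := by
    ext i j
    by_cases h : i < n ∧ j < n <;> simp [padFun_apply, h]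
  map_add' X Y := by
    ext i j
    by_cases h : i < n ∧ j < n <;> simp [padFun_apply, h]
  map_mul' X Y := by
    ext i k
    rw [mul_apply_left (padFun_bdd n X),
      ← Fin.sum_univ_eq_sum_range (fun j => padFun n X i j * padFun n Y j k) n]
    by_cases h : i < n ∧ k < n
    · simp [padFun_apply, h, CStarMatrix.mul_apply]
    · rw [padFun_apply, dif_neg h]
      rw [not_and_or] at h
      rcases h with h | h <;> simp [padFun_apply, h]
  map_star' X := by
    ext i j
    by_cases h : i < n ∧ j < n
    · simp [padFun_apply, h, CStarMatrix.star_apply]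
    · have h' : ¬ (j < n ∧ i < n) := fun h2 => h h2.symm
      simp only [star_apply, padFun_apply, dif_neg h, dif_neg h', star_zero]

theorem pad_apply (n : ℕ) (X : CStarMatrix (Fin n) (Fin n) A) (i j : ℕ) :
    pad n X i j = if h : i < n ∧ j < n then X ⟨i, h.1⟩ ⟨j, h.2⟩ else 0 := rfl

theorem pad_bdd (n : ℕ) (X : CStarMatrix (Fin n) (Fin n) A) : Bdd n (pad n X) :=
  fun i j h => dif_neg (by omega)

theorem pad_corner {n : ℕ} {M : FinMat A} (h : Bdd n M) : pad n (corner n M) = M := by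
  ext i j
  by_cases hij : i < n ∧ j < n
  · simp [pad_apply, hij]
  · rw [pad_apply, dif_neg hij, h i j (by omega)]

theorem corner_pad (n : ℕ) (X : CStarMatrix (Fin n) (Fin n) A) : corner n (pad n X) = X := by
  ext i j
  simp [pad_apply]

theorem corner_add (n : ℕ) (M N : FinMat A) : corner n (M + N) = corner n M + corner n N := by
  ext i j; simp

theorem corner_smul (n : ℕ) (c : ℂ) (M : FinMat A) : corner n (c • M) = c • corner n M := by
  ext i j; simp

theorem corner_star (n : ℕ) (M : FinMat A) : corner n (star M) = star (corner n M) := by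
  ext i j; simp [CStarMatrix.star_apply]

theorem corner_mul {n : ℕ} {M : FinMat A} (hM : Bdd n M) (N : FinMat A) :
    corner n (M * N) = corner n M * corner n N := by
  ext i k
  rw [corner_apply, mul_apply_left hM, CStarMatrix.mul_apply,
    ← Fin.sum_univ_eq_sum_range (fun j => M i j * N j k)]
  rfl

/-- The inclusion of `M_n(A)` into `M_m(A)` for `n ≤ m`. -/
def padTo (n m : ℕ) (h : n ≤ m) :
    CStarMatrix (Fin n) (Fin n) A →⋆ₙₐ[ℂ] CStarMatrix (Fin m) (Fin m) A where
  toFun X := corner m (pad n X)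
  map_smul' c X := by rw [map_smul, corner_smul]; rfl
  map_zero' := by ext; simp
  map_add' X Y := by rw [map_add, corner_add]
  map_mul' X Y := by rw [map_mul, corner_mul ((pad_bdd n X).mono h)]
  map_star' X := by rw [map_star, corner_star]

theorem padTo_injective (n m : ℕ) (h : n ≤ m) : Function.Injective (padTo (A := A) n m h) := by
  intro X Y hXY
  have h1 : corner m (pad n X) = corner m (pad n Y) := hXY
  have h2 := congrArg (pad m) h1
  rw [pad_corner ((pad_bdd n X).mono h), pad_corner ((pad_bdd n Y).mono h)] at h2
  rw [← corner_pad n X, h2, corner_pad]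

theorem norm_corner_eq {n m : ℕ} {M : FinMat A} (hM : Bdd n M) (h : n ≤ m) :
    ‖corner m M‖ = ‖corner n M‖ := by
  have := NonUnitalStarAlgHom.norm_map (padTo (A := A) n m h) (padTo_injective n m h) (corner n M)
  rw [← this]
  show _ = ‖corner m (pad n (corner n M))‖
  rw [pad_corner hM]

/-- The C*-norm of `M_∞(A)`: the norm in `M_n(A)` of any corner outside of which the matrix
vanishes (see `norm_eq`). -/
instance : Norm (FinMat A) where
  norm M := ‖corner (exists_bdd M).choose M‖

theorem norm_eq {n : ℕ} {M : FinMat A} (h : Bdd n M) : ‖M‖ = ‖corner n M‖ := by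
  have h' := (exists_bdd M).choose_spec
  rcases le_total n (exists_bdd M).choose with hle | hle
  · exact norm_corner_eq h hle
  · exact (norm_corner_eq h' hle).symm

instance : NormedAddCommGroup (FinMat A) :=
  AddGroupNorm.toNormedAddCommGroup
    { toFun := fun M => ‖M‖
      map_zero' := by
        rw [norm_eq (n := 0) (fun _ _ _ => rfl)]
        have : corner 0 (0 : FinMat A) = 0 := by ext i; exact i.elim0
        rw [this, norm_zero]
      add_le' := fun M N => by
        obtain ⟨n, hM, hN⟩ := exists_bdd₂ M N
        rw [norm_eq hM, norm_eq hN, norm_eq (hM.add hN), corner_add]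
        exact norm_add_le _ _
      neg' := fun M => by
        obtain ⟨n, hM⟩ := exists_bdd M
        have h2 : Bdd n (-M) := fun i j h => by rw [neg_apply, hM i j h, neg_zero]
        rw [norm_eq hM, norm_eq h2]
        have : corner n (-M) = -corner n M := by ext; simp
        rw [this, norm_neg]
      eq_zero_of_map_eq_zero' := fun M h => by
        obtain ⟨n, hM⟩ := exists_bdd M
        rw [norm_eq hM, norm_eq_zero] at h
        rw [← pad_corner hM, h, map_zero] }

instance : NonUnitalNormedRing (FinMat A) where
  __ := (inferInstance : NonUnitalRing (FinMat A))
  __ := (inferInstance : NormedAddCommGroup (FinMat A))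
  norm_mul_le M N := by
    obtain ⟨n, hM, hN⟩ := exists_bdd₂ M N
    rw [norm_eq hM, norm_eq hN, norm_eq (hM.mul hN), corner_mul hM]
    exact norm_mul_le _ _

instance : NormedSpace ℂ (FinMat A) where
  norm_smul_le c M := by
    obtain ⟨n, hM⟩ := exists_bdd M
    have h2 : Bdd n (c • M) := fun i j h => by rw [smul_apply, hM i j h, smul_zero]
    rw [norm_eq hM, norm_eq h2, corner_smul]
    exact (norm_smul_le _ _)

instance : CStarRing (FinMat A) where
  norm_mul_self_le M := by
    obtain ⟨n, hM⟩ := exists_bdd M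
    rw [norm_eq hM, norm_eq (hM.star.mul hM), corner_mul hM.star, corner_star,
      CStarRing.norm_star_mul_self]

/-- Every `*`-homomorphism from `M_∞(A)` to a C*-algebra is contractive. -/
theorem norm_hom_le {D : Type*} [NonUnitalCStarAlgebra D] (θ : FinMat A →⋆ₙₐ[ℂ] D)
    (M : FinMat A) : ‖θ M‖ ≤ ‖M‖ := by
  obtain ⟨n, hM⟩ := exists_bdd M
  have h := NonUnitalStarAlgHom.norm_apply_le (θ.comp (pad n)) (corner n M)
  rw [NonUnitalStarAlgHom.comp_apply, pad_corner hM] at h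
  rwa [norm_eq hM]

end FinMat

end FiniteMatrices
section Stabilization

open UniformSpace

/-- The extension of a bounded bilinear map to the completions. -/
def bilinExt {E F G : Type*} [NormedAddCommGroup E] [NormedSpace ℂ E] [NormedAddCommGroup F]
    [NormedSpace ℂ F] [NormedAddCommGroup G] [NormedSpace ℂ G] [CompleteSpace G]
    (f : E →L[ℂ] F →L[ℂ] G) : Completion E →L[ℂ] Completion F →L[ℂ] G :=
  (f.fromCompletion.flip.fromCompletion).flip

theorem bilinExt_coe {E F G : Type*} [NormedAddCommGroup E] [NormedSpace ℂ E]
    [NormedAddCommGroup F] [NormedSpace ℂ F] [NormedAddCommGroup G] [NormedSpace ℂ G]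
    [CompleteSpace G] (f : E →L[ℂ] F →L[ℂ] G) (x : E) (y : F) :
    bilinExt f (x : Completion E) (y : Completion F) = f x y := by
  simp only [bilinExt, ContinuousLinearMap.flip_apply, ContinuousLinearMap.fromCompletion_apply_coe]

variable (A : Type u) [CStarAlgebra A]

/-- The stabilization `A ⊗ 𝒦`, where `𝒦` is the algebra of compact operators on `ℓ²(ℕ)`: the
completion of `M_∞(A)`. -/
def Stab : Type u := Completion (FinMat A)

namespace Stab

variable {A}

instance : NormedAddCommGroup (Stab A) := inferInstanceAs (NormedAddCommGroup (Completion (FinMat A)))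
instance : NormedSpace ℂ (Stab A) := inferInstanceAs (NormedSpace ℂ (Completion (FinMat A)))
instance : CompleteSpace (Stab A) := inferInstanceAs (CompleteSpace (Completion (FinMat A)))

/-- The inclusion of `M_∞(A)` into `A ⊗ 𝒦`. -/
def of : FinMat A →ₗᵢ[ℂ] Stab A := Completion.toComplₗᵢ

theorem norm_of (M : FinMat A) : ‖of M‖ = ‖M‖ := of.norm_map M

theorem continuous_of : Continuous (of : FinMat A → Stab A) := of.continuous

theorem denseRange_of : DenseRange (of : FinMat A → Stab A) := Completion.denseRange_coe

theorem induction₁ {p : Stab A → Prop} (x : Stab A) (hp : IsClosed {x | p x})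
    (ih : ∀ M : FinMat A, p (of M)) : p x :=
  Completion.induction_on x hp ih

theorem induction₂ {B : Type v} [CStarAlgebra B] {p : Stab A → Stab B → Prop}
    (x : Stab A) (y : Stab B) (hp : IsClosed {z : Stab A × Stab B | p z.1 z.2})
    (ih : ∀ (M : FinMat A) (N : FinMat B), p (of M) (of N)) : p x y :=
  Completion.induction_on₂ x y hp ih

/-- The multiplication of `A ⊗ 𝒦` as a bounded bilinear map. -/
def mulL : Stab A →L[ℂ] Stab A →L[ℂ] Stab A :=
  bilinExt ((ContinuousLinearMap.compL ℂ (FinMat A) (FinMat A) (Stab A)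
    of.toContinuousLinearMap) ∘L ContinuousLinearMap.mul ℂ (FinMat A))

instance : Mul (Stab A) := ⟨fun x y => mulL x y⟩

theorem mul_def (x y : Stab A) : x * y = mulL x y := rfl

theorem of_mul (M N : FinMat A) : of (M * N) = of M * of N :=
  (bilinExt_coe ((ContinuousLinearMap.compL ℂ (FinMat A) (FinMat A) (Stab A)
    of.toContinuousLinearMap) ∘L ContinuousLinearMap.mul ℂ (FinMat A)) M N).symm

theorem continuous_mul' : Continuous fun z : Stab A × Stab A => z.1 * z.2 :=
  (mulL (A := A)).continuous₂

instance : ContinuousMul (Stab A) := ⟨continuous_mul'⟩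

instance : Star (Stab A) := ⟨Completion.map star⟩

theorem uniformContinuous_star_finMat : UniformContinuous (star : FinMat A → FinMat A) :=
  star_isometry.uniformContinuous

theorem of_star (M : FinMat A) : of (star M) = star (of M) :=
  (Completion.map_coe uniformContinuous_star_finMat M).symm

theorem continuous_star' : Continuous fun x : Stab A => star x :=
  Completion.continuous_map

instance : NonUnitalRing (Stab A) where
  left_distrib x y z := by simp only [mul_def, map_add]
  right_distrib x y z := by simp only [mul_def, map_add, _root_.add_apply]
  zero_mul x := by simp only [mul_def, map_zero, _root_.zero_apply]
  mul_zero x := by simp only [mul_def, map_zero]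
  mul_assoc x y z := by
    refine induction₁ (p := fun x => x * y * z = x * (y * z)) x
      (isClosed_eq (by fun_prop) (by fun_prop)) fun M => ?_
    refine induction₁ (p := fun y => of M * y * z = of M * (y * z)) y
      (isClosed_eq (by fun_prop) (by fun_prop)) fun N => ?_
    refine induction₁ (p := fun z => of M * of N * z = of M * (of N * z)) z
      (isClosed_eq (by fun_prop) (by fun_prop)) fun P => ?_
    rw [← of_mul, ← of_mul, ← of_mul, ← of_mul, mul_assoc]

instance : IsScalarTower ℂ (Stab A) (Stab A) where
  smul_assoc c x y := by simp only [smul_eq_mul, mul_def, map_smul, _root_.smul_apply]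

instance : SMulCommClass ℂ (Stab A) (Stab A) where
  smul_comm c x y := by simp only [smul_eq_mul, mul_def, map_smul]

instance : NonUnitalNormedRing (Stab A) where
  __ := (inferInstance : NonUnitalRing (Stab A))
  __ := (inferInstance : NormedAddCommGroup (Stab A))
  norm_mul_le x y := by
    refine induction₂ (p := fun x y => ‖x * y‖ ≤ ‖x‖ * ‖y‖) x y
      (isClosed_le (by fun_prop) (by fun_prop)) fun M N => ?_
    rw [← of_mul, norm_of, norm_of, norm_of]
    exact norm_mul_le M N

instance : ContinuousStar (Stab A) := ⟨continuous_star'⟩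

instance : StarRing (Stab A) where
  star_involutive x := by
    refine induction₁ (p := fun x => star (star x) = x) x
      (isClosed_eq (by fun_prop) (by fun_prop)) fun M => ?_
    rw [← of_star, ← of_star, star_star]
  star_mul x y := by
    refine induction₂ (p := fun x y => star (x * y) = star y * star x) x y
      (isClosed_eq (by fun_prop) (by fun_prop)) fun M N => ?_
    rw [← of_mul, ← of_star, ← of_star, ← of_star, ← of_mul, star_mul]
  star_add x y := by
    refine induction₂ (p := fun x y => star (x + y) = star x + star y) x y
      (isClosed_eq (by fun_prop) (by fun_prop)) fun M N => ?_
    rw [← map_add, ← of_star, ← of_star, ← of_star, ← map_add, star_add]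

instance : CStarRing (Stab A) where
  norm_mul_self_le x := by
    refine induction₁ (p := fun x => ‖x‖ * ‖x‖ ≤ ‖star x * x‖) x
      (isClosed_le (by fun_prop) (by fun_prop)) fun M => ?_
    rw [← of_star, ← of_mul, norm_of, norm_of]
    exact CStarRing.norm_mul_self_le M

instance : StarModule ℂ (Stab A) where
  star_smul c x := by
    refine induction₁ (p := fun x => star (c • x) = star c • star x) x
      (isClosed_eq (continuous_star'.comp (continuous_const_smul c))
        ((continuous_const_smul (star c)).comp continuous_star')) fun M => ?_
    rw [← map_smul, ← of_star, ← of_star, ← map_smul, star_smul]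

/-- `A ⊗ 𝒦` is a C*-algebra. -/
instance : NonUnitalCStarAlgebra (Stab A) where

/-- The inclusion of `M_∞(A)` into `A ⊗ 𝒦` as a `*`-homomorphism. -/
def ofHom : FinMat A →⋆ₙₐ[ℂ] Stab A where
  toFun := of
  map_smul' := map_smul of
  map_zero' := map_zero of
  map_add' := map_add of
  map_mul' := of_mul
  map_star' := of_star

/-- A `*`-homomorphism from `M_∞(A)` to a C*-algebra as a bounded linear map. -/
def homL {D : Type*} [NonUnitalCStarAlgebra D] (θ : FinMat A →⋆ₙₐ[ℂ] D) : FinMat A →L[ℂ] D :=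
  LinearMap.mkContinuous
    { toFun := θ
      map_add' := map_add θ
      map_smul' := map_smul θ } 1
    (fun M => by rw [one_mul]; exact FinMat.norm_hom_le θ M)

/-- The bounded extension to `A ⊗ 𝒦` of a `*`-homomorphism from `M_∞(A)` to a C*-algebra. -/
def liftL {D : Type*} [NonUnitalCStarAlgebra D] (θ : FinMat A →⋆ₙₐ[ℂ] D) : Stab A →L[ℂ] D :=
  (homL θ).fromCompletion

theorem liftL_of {D : Type*} [NonUnitalCStarAlgebra D] (θ : FinMat A →⋆ₙₐ[ℂ] D) (M : FinMat A) :
    liftL θ (of M) = θ M :=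
  ContinuousLinearMap.fromCompletion_apply_coe (homL θ) M

/-- The extension to `A ⊗ 𝒦` of a `*`-homomorphism from `M_∞(A)` to a C*-algebra. -/
def lift {D : Type*} [NonUnitalCStarAlgebra D] (θ : FinMat A →⋆ₙₐ[ℂ] D) : Stab A →⋆ₙₐ[ℂ] D where
  toFun := liftL θ
  map_smul' c x := map_smul (liftL θ) c x
  map_zero' := map_zero (liftL θ)
  map_add' := map_add (liftL θ)
  map_mul' x y := by
    refine induction₂ (p := fun x y => liftL θ (x * y) = liftL θ x * liftL θ y) x y
      (isClosed_eq (by fun_prop) (by fun_prop)) fun M N => ?_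
    rw [← of_mul, liftL_of, liftL_of, liftL_of, map_mul]
  map_star' x := by
    refine induction₁ (p := fun x => liftL θ (star x) = star (liftL θ x)) x
      (isClosed_eq (by fun_prop) (by fun_prop)) fun M => ?_
    rw [← of_star, liftL_of, liftL_of, map_star]

theorem lift_of {D : Type*} [NonUnitalCStarAlgebra D] (θ : FinMat A →⋆ₙₐ[ℂ] D) (M : FinMat A) :
    lift θ (of M) = θ M := liftL_of θ M

theorem continuous_lift {D : Type*} [NonUnitalCStarAlgebra D] (θ : FinMat A →⋆ₙₐ[ℂ] D) :
    Continuous (lift θ) := (liftL θ).continuous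

end Stab

end Stabilization
section Embeddings

open Finset

variable {A : Type u} [CStarAlgebra A]

namespace FinMat

/-- The matrix with entry `M i j` at `(f i, f j)` and zeros elsewhere. -/
def embFun (f : ℕ ↪ ℕ) (M : FinMat A) : FinMat A :=
  mk (fun p q => Function.extend f (fun i => Function.extend f (fun j => M i j) 0 q) 0 p) <| by
    obtain ⟨n, hM⟩ := exists_bdd M
    refine ⟨(range n).sup (fun i => f i + 1), fun p q h => ?_⟩
    by_cases hp : ∃ i, f i = p
    · obtain ⟨i, rfl⟩ := hp
      rw [f.injective.extend_apply]
      by_cases hq : ∃ j, f j = q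
      · obtain ⟨j, rfl⟩ := hq
        rw [f.injective.extend_apply]
        refine hM i j ?_
        by_contra hc
        push Not at hc
        have h1 := le_sup (f := fun i => f i + 1) (mem_range.2 hc.1)
        have h2 := le_sup (f := fun i => f i + 1) (mem_range.2 hc.2)
        omega
      · rw [Function.extend_apply' _ _ _ hq]; rfl
    · rw [Function.extend_apply' _ _ _ hp]; rfl

theorem embFun_apply (f : ℕ ↪ ℕ) (M : FinMat A) (i j : ℕ) : embFun f M (f i) (f j) = M i j := by
  show Function.extend f (fun i => Function.extend f (fun j => M i j) 0 (f j)) 0 (f i) = _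
  rw [f.injective.extend_apply, f.injective.extend_apply]

theorem embFun_apply_left (f : ℕ ↪ ℕ) (M : FinMat A) {p : ℕ} (q : ℕ) (hp : ¬ ∃ i, f i = p) :
    embFun f M p q = 0 := by
  show Function.extend f (fun i => Function.extend f (fun j => M i j) 0 q) 0 p = _
  rw [Function.extend_apply' _ _ _ hp]; rfl

theorem embFun_apply_right (f : ℕ ↪ ℕ) (M : FinMat A) (p : ℕ) {q : ℕ} (hq : ¬ ∃ i, f i = q) :
    embFun f M p q = 0 := by
  by_cases hp : ∃ i, f i = p
  · obtain ⟨i, rfl⟩ := hp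
    show Function.extend f (fun i => Function.extend f (fun j => M i j) 0 q) 0 (f i) = _
    rw [f.injective.extend_apply, Function.extend_apply' _ _ _ hq]; rfl
  · exact embFun_apply_left f M q hp

theorem ext_range (f : ℕ ↪ ℕ) {M N : FinMat A} (h : ∀ i j, M (f i) (f j) = N (f i) (f j))
    (hl : ∀ p q, (¬ ∃ i, f i = p) → M p q = N p q)
    (hr : ∀ p q, (¬ ∃ i, f i = q) → M p q = N p q) : M = N := by
  ext p q
  by_cases hp : ∃ i, f i = p
  · by_cases hq : ∃ j, f j = q
    · obtain ⟨i, rfl⟩ := hp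
      obtain ⟨j, rfl⟩ := hq
      exact h i j
    · exact hr p q hq
  · exact hl p q hp

theorem embFun_mul (f : ℕ ↪ ℕ) (M N : FinMat A) :
    embFun f (M * N) = embFun f M * embFun f N := by
  obtain ⟨K, hK⟩ := exists_bdd (embFun f M)
  refine ext_range f (fun i k => ?_) (fun p q hp => ?_) (fun p q hq => ?_)
  · obtain ⟨n, hM⟩ := exists_bdd M
    rw [embFun_apply, mul_apply_left hM, mul_apply_left (hK.mono (le_max_left K
      ((range n).sup (fun i => f i + 1))))]
    have hsub : (range n).map f ⊆ range (max K ((range n).sup (fun i => f i + 1))) := by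
      intro q hq
      obtain ⟨j, hj, rfl⟩ := mem_map.1 hq
      have h1 := le_sup (f := fun i => f i + 1) hj
      rw [mem_range]
      omega
    rw [← sum_subset hsub, sum_map]
    · simp only [embFun_apply]
    · intro q _ hq
      by_cases hq' : ∃ j, f j = q
      · obtain ⟨j, rfl⟩ := hq'
        have hj : n ≤ j := by
          by_contra hc
          exact hq (mem_map_of_mem f (mem_range.2 (by omega)))
        rw [embFun_apply, hM i j (Or.inr hj), zero_mul]
      · rw [embFun_apply_right f M _ hq', zero_mul]
  · rw [embFun_apply_left f _ q hp, mul_apply_left hK]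
    exact (sum_eq_zero fun j _ => by rw [embFun_apply_left f _ j hp, zero_mul]).symm
  · rw [embFun_apply_right f _ p hq, mul_apply_left hK]
    exact (sum_eq_zero fun j _ => by rw [embFun_apply_right f _ j hq, mul_zero]).symm

/-- `embFun` as a `*`-homomorphism. -/
def emb (f : ℕ ↪ ℕ) : FinMat A →⋆ₙₐ[ℂ] FinMat A where
  toFun := embFun f
  map_smul' c M := by
    refine ext_range f (fun i k => ?_) (fun p q hp => ?_) (fun p q hq => ?_)
    · simp [embFun_apply]
    · simp [embFun_apply_left f _ _ hp]
    · simp [embFun_apply_right f _ _ hq]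
  map_zero' := by
    refine ext_range f (fun i k => ?_) (fun p q hp => ?_) (fun p q hq => ?_)
    · simp [embFun_apply]
    · simp [embFun_apply_left f _ _ hp]
    · simp [embFun_apply_right f _ _ hq]
  map_add' M N := by
    refine ext_range f (fun i k => ?_) (fun p q hp => ?_) (fun p q hq => ?_)
    · simp [embFun_apply]
    · simp [embFun_apply_left f _ _ hp]
    · simp [embFun_apply_right f _ _ hq]
  map_mul' := embFun_mul f
  map_star' M := by
    refine ext_range f (fun i k => ?_) (fun p q hp => ?_) (fun p q hq => ?_)
    · simp [embFun_apply]
    · simp [embFun_apply_left f _ _ hp, embFun_apply_right f _ _ hp]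
    · simp [embFun_apply_left f _ _ hq, embFun_apply_right f _ _ hq]

theorem emb_eq (f : ℕ ↪ ℕ) (M : FinMat A) : emb f M = embFun f M := rfl

theorem emb_emb (f g : ℕ ↪ ℕ) (M : FinMat A) : emb g (emb f M) = emb (f.trans g) M := by
  simp only [emb_eq]
  refine ext_range (f.trans g) (fun i k => ?_) (fun p q hp => ?_) (fun p q hq => ?_)
  · rw [embFun_apply]
    simp only [Function.Embedding.trans_apply, embFun_apply]
  · rw [embFun_apply_left _ _ q hp]
    by_cases h : ∃ j, g j = p
    · obtain ⟨j, rfl⟩ := h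
      have hj : ¬ ∃ i, f i = j := fun ⟨i, hi⟩ => hp ⟨i, by simp [hi]⟩
      by_cases h' : ∃ l, g l = q
      · obtain ⟨l, rfl⟩ := h'
        rw [embFun_apply, embFun_apply_left _ _ l hj]
      · rw [embFun_apply_right _ _ _ h']
    · rw [embFun_apply_left _ _ _ h]
  · rw [embFun_apply_right _ _ p hq]
    by_cases h : ∃ j, g j = q
    · obtain ⟨j, rfl⟩ := h
      have hj : ¬ ∃ i, f i = j := fun ⟨i, hi⟩ => hq ⟨i, by simp [hi]⟩
      by_cases h' : ∃ l, g l = p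
      · obtain ⟨l, rfl⟩ := h'
        rw [embFun_apply, embFun_apply_right _ _ l hj]
      · rw [embFun_apply_left _ _ _ h']
    · rw [embFun_apply_right _ _ _ h]

theorem emb_mul_emb_eq_zero {f g : ℕ ↪ ℕ} (hfg : ∀ i j, f i ≠ g j) (M N : FinMat A) :
    emb f M * emb g N = 0 := by
  obtain ⟨K, hK⟩ := exists_bdd (emb f M)
  ext p q
  rw [mul_apply_left hK]
  refine sum_eq_zero fun r _ => ?_
  by_cases hr : ∃ i, f i = r
  · have hr' : ¬ ∃ j, g j = r := fun ⟨j, hj⟩ => by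
      obtain ⟨i, hi⟩ := hr
      exact hfg i j (hi.trans hj.symm)
    rw [emb_eq, emb_eq, embFun_apply_left g _ _ hr', mul_zero]
  · rw [emb_eq, embFun_apply_right f _ _ hr, zero_mul]

/-- The partial isometry with entries `1` at `(f i, i)` for `i < n`. -/
def shift (f : ℕ ↪ ℕ) (n : ℕ) : FinMat A :=
  mk (fun p q => if p = f q ∧ q < n then 1 else 0) <| by
    refine ⟨max n ((range n).sup (fun i => f i + 1)), fun p q h => ?_⟩
    refine if_neg fun hc => ?_
    have h1 := le_sup (f := fun i => f i + 1) (mem_range.2 hc.2)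
    omega

theorem shift_apply (f : ℕ ↪ ℕ) (n p q : ℕ) :
    (shift f n : FinMat A) p q = if p = f q ∧ q < n then 1 else 0 := rfl

theorem shift_mul_apply (f : ℕ ↪ ℕ) {n : ℕ} {M : FinMat A} (hM : Bdd n M) (i q : ℕ) :
    (shift f n * M : FinMat A) (f i) q = M i q := by
  rw [mul_apply_right _ (hM), ]
  rw [sum_eq_single i]
  · by_cases hi : i < n
    · simp [shift_apply, hi]
    · simp [shift_apply, hi, hM i q (Or.inl (by omega))]
  · intro j _ hj
    simp [shift_apply, (Ne.symm hj)]
  · intro hi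
    rw [hM i q (Or.inl (by simpa using hi)), mul_zero]

theorem shift_mul_apply' (f : ℕ ↪ ℕ) (n : ℕ) (M : FinMat A) {p : ℕ} (q : ℕ)
    (hp : ¬ ∃ i, f i = p) : (shift f n * M : FinMat A) p q = 0 := by
  obtain ⟨K, hK⟩ := exists_bdd (shift f n : FinMat A)
  rw [mul_apply_left hK]
  refine sum_eq_zero fun r _ => ?_
  rw [shift_apply, if_neg (fun h => hp ⟨r, h.1.symm⟩), zero_mul]

theorem shift_mul_mul_star (f : ℕ ↪ ℕ) {n : ℕ} {M : FinMat A} (hM : Bdd n M) :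
    shift f n * M * star (shift f n) = emb f M := by
  have hs : shift f n * M * star (shift f n) = star (shift f n * star (shift f n * M)) := by
    simp
  refine ext_range f (fun i k => ?_) (fun p q hp => ?_) (fun p q hq => ?_)
  · rw [emb_eq, embFun_apply, hs, star_apply]
    obtain ⟨K, hK⟩ := exists_bdd (shift f n * M)
    have hB : ∀ a b, n ≤ b → (shift f n * M : FinMat A) a b = 0 := by
      intro a b hb
      obtain ⟨L, hL⟩ := exists_bdd (shift f n : FinMat A)
      rw [mul_apply_left hL]
      exact sum_eq_zero fun r _ => by rw [hM r b (Or.inr hb), mul_zero]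
    rw [mul_apply_right _ hK.star]
    rw [sum_eq_single k]
    · by_cases hk : k < n
      · simp only [shift_apply, hk, and_self, if_true, one_mul, star_apply, star_star]
        exact shift_mul_apply f hM i k
      · rw [hM i k (Or.inr (by omega)), star_apply, hB _ _ (by omega)]
        simp
    · intro j _ hj
      simp [shift_apply, (Ne.symm hj)]
    · intro hk
      rw [star_apply, hK _ k (Or.inr (by simpa using hk))]
      simp
  · rw [emb_eq, embFun_apply_left f _ q hp, mul_assoc, shift_mul_apply' f n _ q hp]
  · rw [emb_eq, embFun_apply_right f _ p hq, hs, star_apply, shift_mul_apply' f n _ p hq, star_zero]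

theorem star_shift_mul_shift_apply (f : ℕ ↪ ℕ) (n i j : ℕ) :
    (star (shift f n) * shift f n : FinMat A) i j = if i = j ∧ j < n then 1 else 0 := by
  obtain ⟨K, hK⟩ := exists_bdd (shift f n : FinMat A)
  rw [mul_apply_left hK.star]
  by_cases h : i = j ∧ j < n
  · obtain ⟨rfl, h⟩ := h
    rw [sum_eq_single (f i)]
    · simp [shift_apply, h]
    · intro p _ hp
      simp [shift_apply, hp]
    · intro hp
      rw [star_apply, hK (f i) i (Or.inl (by simpa using hp))]
      simp
  · rw [if_neg h]
    refine sum_eq_zero fun p _ => ?_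
    simp only [star_apply, shift_apply]
    by_cases h1 : p = f i ∧ i < n
    · by_cases h2 : p = f j ∧ j < n
      · exact absurd ⟨f.injective (h1.1.symm.trans h2.1), h2.2⟩ h
      · rw [if_neg h2, mul_zero]
    · rw [if_neg h1, star_zero, zero_mul]

theorem star_shift_mul_shift_mul (f : ℕ ↪ ℕ) {n : ℕ} {M : FinMat A} (hM : Bdd n M) :
    star (shift f n) * shift f n * M = M := by
  ext i j
  rw [mul_apply_right _ hM]
  simp only [star_shift_mul_shift_apply]
  rw [sum_eq_single i]
  · by_cases hi : i < n
    · simp [hi]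
    · simp [hi, hM i j (Or.inl (by omega))]
  · intro k _ hk
    simp [Ne.symm hk]
  · intro hi
    rw [hM i j (Or.inl (by simpa using hi)), mul_zero]

theorem mul_star_shift_mul_shift (f : ℕ ↪ ℕ) {n : ℕ} {M : FinMat A} (hM : Bdd n M) :
    M * (star (shift f n) * shift f n) = M := by
  have h := congrArg star (star_shift_mul_shift_mul f hM.star)
  simpa [mul_assoc] using h

theorem star_shift_mul_emb_mul (f : ℕ ↪ ℕ) {n : ℕ} {M : FinMat A} (hM : Bdd n M) :
    star (shift f n) * emb f M * shift f n = M := by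
  rw [← shift_mul_mul_star f hM]
  calc star (shift f n) * (shift f n * M * star (shift f n)) * shift f n
      = (star (shift f n) * shift f n * M) * (star (shift f n) * shift f n) := by
        simp only [mul_assoc]
    _ = M := by rw [star_shift_mul_shift_mul f hM, mul_star_shift_mul_shift f hM]

theorem norm_shift_le (f : ℕ ↪ ℕ) (n : ℕ) : ‖(shift f n : FinMat A)‖ ≤ 1 := by
  set P : FinMat A := star (shift f n) * shift f n with hP
  have hb : Bdd n P := by
    intro i j h
    rw [hP, star_shift_mul_shift_apply, if_neg (by omega)]
  have h1 : star P * P = P := by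
    have : star P = P := by simp [hP]
    rw [this]
    exact star_shift_mul_shift_mul f hb
  have h2 : ‖P‖ * ‖P‖ = ‖P‖ := by rw [← CStarRing.norm_star_mul_self (x := P), h1]
  have h3 : ‖P‖ ≤ 1 := by
    by_contra hc
    push Not at hc
    nlinarith
  have h4 : ‖P‖ = ‖(shift f n : FinMat A)‖ * ‖(shift f n : FinMat A)‖ :=
    CStarRing.norm_star_mul_self
  by_contra hc
  push Not at hc
  nlinarith

end FinMat

namespace Stab

/-- The `*`-endomorphism of `A ⊗ 𝒦` moving the entry at `(i, j)` to `(f i, f j)`, that is,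
`x ↦ (1 ⊗ s) x (1 ⊗ s)*` for the isometry `s` of `ℓ²(ℕ)` with `s eᵢ = e_(f i)`. -/
def emb (f : ℕ ↪ ℕ) : Stab A →⋆ₙₐ[ℂ] Stab A := lift (ofHom.comp (FinMat.emb f))

theorem emb_of (f : ℕ ↪ ℕ) (M : FinMat A) : emb f (of M) = of (FinMat.emb f M) := lift_of _ M

theorem continuous_emb (f : ℕ ↪ ℕ) : Continuous (emb f : Stab A → Stab A) := continuous_lift _

theorem norm_emb_le (f : ℕ ↪ ℕ) (x : Stab A) : ‖emb f x‖ ≤ ‖x‖ :=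
  NonUnitalStarAlgHom.norm_apply_le (emb f) x

theorem emb_emb (f g : ℕ ↪ ℕ) (x : Stab A) : emb g (emb f x) = emb (f.trans g) x := by
  refine induction₁ (p := fun x => emb g (emb f x) = emb (f.trans g) x) x
    (isClosed_eq ((continuous_emb g).comp (continuous_emb f)) (continuous_emb _)) fun M => ?_
  rw [emb_of, emb_of, emb_of, FinMat.emb_emb]

theorem emb_mul_emb_eq_zero {f g : ℕ ↪ ℕ} (hfg : ∀ i j, f i ≠ g j) (x y : Stab A) :
    emb f x * emb g y = 0 := by
  refine induction₂ (p := fun x y => emb f x * emb g y = 0) x y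
    (isClosed_eq (((continuous_emb f).comp continuous_fst).mul
      ((continuous_emb g).comp continuous_snd)) continuous_const) fun M N => ?_
  rw [emb_of, emb_of, ← of_mul, FinMat.emb_mul_emb_eq_zero hfg, map_zero]

end Stab

end Embeddings
section CuntzSemigroup

variable {A : Type u} [CStarAlgebra A]

/-- Cuntz subequivalence in `A ⊗ 𝒦`: `a` is a limit of elements of the form `d b d*`. -/
def CuntzLE (a b : Stab A) : Prop := ∀ ε : ℝ, 0 < ε → ∃ d : Stab A, ‖d * b * star d - a‖ < ε

theorem CuntzLE.trans {a b c : Stab A} (hab : CuntzLE a b) (hbc : CuntzLE b c) : CuntzLE a c := by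
  intro ε hε
  obtain ⟨d, hd⟩ := hab (ε / 2) (by positivity)
  obtain ⟨e, he⟩ := hbc (ε / 2 / (‖d‖ * ‖d‖ + 1)) (by positivity)
  refine ⟨d * e, ?_⟩
  have h1 : d * e * c * star (d * e) - a
      = d * (e * c * star e - b) * star d + (d * b * star d - a) := by
    simp only [star_mul, mul_sub, sub_mul, mul_assoc]
    abel
  have h2 : ‖d * (e * c * star e - b) * star d‖ ≤ ε / 2 := by
    calc ‖d * (e * c * star e - b) * star d‖
        ≤ ‖d‖ * ‖e * c * star e - b‖ * ‖star d‖ :=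
          (norm_mul_le _ _).trans (mul_le_mul_of_nonneg_right (norm_mul_le _ _) (norm_nonneg _))
      _ = (‖d‖ * ‖d‖) * ‖e * c * star e - b‖ := by rw [norm_star]; ring
      _ ≤ (‖d‖ * ‖d‖ + 1) * (ε / 2 / (‖d‖ * ‖d‖ + 1)) := by
          gcongr
          linarith
      _ = ε / 2 := by field_simp
  rw [h1]
  linarith [norm_add_le (d * (e * c * star e - b) * star d) (d * b * star d - a)]

/-- If `T` is implemented on `M_∞(A)` by compressing the values of `S` with contractions, then
`T a ≾ S a` for all `a`. -/
theorem cuntzLE_of_implemented {T S : Stab A →⋆ₙₐ[ℂ] Stab A}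
    (h : ∀ M : FinMat A, ∃ d : FinMat A, ‖d‖ ≤ 1 ∧
      Stab.of d * S (Stab.of M) * star (Stab.of d) = T (Stab.of M)) (a : Stab A) :
    CuntzLE (T a) (S a) := by
  intro ε hε
  obtain ⟨M, hM⟩ := Stab.denseRange_of.exists_dist_lt a (half_pos hε)
  obtain ⟨d, hd1, hd⟩ := h M
  refine ⟨Stab.of d, ?_⟩
  rw [dist_eq_norm] at hM
  have h1 : Stab.of d * S a * star (Stab.of d) - T a
      = Stab.of d * S (a - Stab.of M) * star (Stab.of d) - T (a - Stab.of M) := by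
    rw [map_sub, map_sub, mul_sub, sub_mul, hd]
    abel
  have h2 : ‖Stab.of d * S (a - Stab.of M) * star (Stab.of d)‖ ≤ ‖a - Stab.of M‖ := by
    calc ‖Stab.of d * S (a - Stab.of M) * star (Stab.of d)‖
        ≤ ‖Stab.of d‖ * ‖S (a - Stab.of M)‖ * ‖star (Stab.of d)‖ :=
          (norm_mul_le _ _).trans (mul_le_mul_of_nonneg_right (norm_mul_le _ _) (norm_nonneg _))
      _ ≤ 1 * ‖a - Stab.of M‖ * 1 := by
          rw [norm_star, Stab.norm_of]
          gcongr
          exact NonUnitalStarAlgHom.norm_apply_le S _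
      _ = ‖a - Stab.of M‖ := by ring
  have h3 : ‖T (a - Stab.of M)‖ ≤ ‖a - Stab.of M‖ := NonUnitalStarAlgHom.norm_apply_le T _
  rw [h1]
  linarith [norm_sub_le (Stab.of d * S (a - Stab.of M) * star (Stab.of d)) (T (a - Stab.of M))]

theorem cuntzLE_emb (f : ℕ ↪ ℕ) (a : Stab A) : CuntzLE (Stab.emb f a) a := by
  refine cuntzLE_of_implemented (T := Stab.emb f) (S := NonUnitalStarAlgHom.id ℂ (Stab A))
    (fun M => ?_) a
  obtain ⟨n, hM⟩ := FinMat.exists_bdd M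
  refine ⟨FinMat.shift f n, FinMat.norm_shift_le f n, ?_⟩
  change Stab.of _ * Stab.of M * star (Stab.of _) = _
  rw [← Stab.of_star, ← Stab.of_mul, ← Stab.of_mul,
    FinMat.shift_mul_mul_star f hM, Stab.emb_of]

theorem emb_cuntzLE (f : ℕ ↪ ℕ) (a : Stab A) : CuntzLE a (Stab.emb f a) := by
  refine cuntzLE_of_implemented (T := NonUnitalStarAlgHom.id ℂ (Stab A)) (S := Stab.emb f)
    (fun M => ?_) a
  obtain ⟨n, hM⟩ := FinMat.exists_bdd M
  refine ⟨star (FinMat.shift f n), (norm_star _).trans_le (FinMat.norm_shift_le f n), ?_⟩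
  change _ = Stab.of M
  rw [← Stab.of_star, star_star, Stab.emb_of, ← Stab.of_mul,
    ← Stab.of_mul, FinMat.star_shift_mul_emb_mul f hM]

theorem CuntzLE.refl (a : Stab A) : CuntzLE a a :=
  (emb_cuntzLE (Function.Embedding.refl ℕ) a).trans (cuntzLE_emb _ a)

/-- The embedding `n ↦ 2n`. -/
def evenEmb : ℕ ↪ ℕ := ⟨fun n => 2 * n, fun a b h => by simpa using h⟩

/-- The embedding `n ↦ 2n + 1`. -/
def oddEmb : ℕ ↪ ℕ := ⟨fun n => 2 * n + 1, fun a b h => by simpa using h⟩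

theorem evenEmb_ne_oddEmb (i j : ℕ) : evenEmb i ≠ oddEmb j := by
  show 2 * i ≠ 2 * j + 1
  omega

/-- The orthogonal sum `a ⊕ b` in `A ⊗ 𝒦`, formed by means of the decomposition of `ℓ²(ℕ)` into
its even and its odd part. -/
def dsum (a b : Stab A) : Stab A := Stab.emb evenEmb a + Stab.emb oddEmb b

theorem dsum_mul (a b c d : Stab A) : dsum a b * dsum c d = dsum (a * c) (b * d) := by
  simp only [dsum, add_mul, mul_add, map_mul, Stab.emb_mul_emb_eq_zero evenEmb_ne_oddEmb,
    Stab.emb_mul_emb_eq_zero (fun i j => (evenEmb_ne_oddEmb j i).symm)]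
  abel

theorem star_dsum (a b : Stab A) : star (dsum a b) = dsum (star a) (star b) := by
  simp only [dsum, star_add, map_star]

theorem dsum_sub (a b c d : Stab A) : dsum a b - dsum c d = dsum (a - c) (b - d) := by
  simp only [dsum, map_sub]
  abel

theorem norm_dsum_le (a b : Stab A) : ‖dsum a b‖ ≤ ‖a‖ + ‖b‖ :=
  (norm_add_le _ _).trans (add_le_add (Stab.norm_emb_le _ a) (Stab.norm_emb_le _ b))

theorem CuntzLE.dsum {a b c d : Stab A} (hac : CuntzLE a c) (hbd : CuntzLE b d) :
    CuntzLE (dsum a b) (dsum c d) := by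
  intro ε hε
  obtain ⟨x, hx⟩ := hac (ε / 2) (by positivity)
  obtain ⟨y, hy⟩ := hbd (ε / 2) (by positivity)
  refine ⟨CuntzDiv.dsum x y, ?_⟩
  rw [dsum_mul, star_dsum, dsum_mul, dsum_sub]
  linarith [norm_dsum_le (x * c * star x - a) (y * d * star y - b)]

/-- A permutation carrying the blocks of `(a ⊕ b) ⊕ c` to those of `a ⊕ (b ⊕ c)`. -/
def assocEmb : ℕ ↪ ℕ :=
  ⟨fun n => if n % 4 = 0 then n / 2 else if n % 4 = 2 then n - 1 else 2 * n + 1, fun a b h => by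
    simp only at h
    split_ifs at h <;> omega⟩

/-- The permutation exchanging even and odd numbers. -/
def swapEmb : ℕ ↪ ℕ :=
  ⟨fun n => if n % 2 = 0 then n + 1 else n - 1, fun a b h => by
    simp only at h
    split_ifs at h <;> omega⟩

theorem evenEmb_apply (n : ℕ) : evenEmb n = 2 * n := rfl

theorem oddEmb_apply (n : ℕ) : oddEmb n = 2 * n + 1 := rfl

theorem assocEmb_apply (n : ℕ) :
    assocEmb n = if n % 4 = 0 then n / 2 else if n % 4 = 2 then n - 1 else 2 * n + 1 := rfl

theorem swapEmb_apply (n : ℕ) : swapEmb n = if n % 2 = 0 then n + 1 else n - 1 := rfl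

theorem emb_assocEmb_dsum (a b c : Stab A) :
    Stab.emb assocEmb (dsum (dsum a b) c) = dsum a (dsum b c) := by
  have h1 : (evenEmb.trans evenEmb).trans assocEmb = evenEmb := by
    ext n
    simp only [Function.Embedding.trans_apply, evenEmb_apply, assocEmb_apply]
    split_ifs <;> omega
  have h2 : (oddEmb.trans evenEmb).trans assocEmb = evenEmb.trans oddEmb := by
    ext n
    simp only [Function.Embedding.trans_apply, evenEmb_apply, oddEmb_apply, assocEmb_apply]
    split_ifs <;> omega
  have h3 : oddEmb.trans assocEmb = oddEmb.trans oddEmb := by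
    ext n
    simp only [Function.Embedding.trans_apply, oddEmb_apply, assocEmb_apply]
    split_ifs <;> omega
  simp only [dsum, map_add, Stab.emb_emb, h1, h2, h3]
  abel

theorem emb_swapEmb_dsum (a b : Stab A) : Stab.emb swapEmb (dsum a b) = dsum b a := by
  have h1 : evenEmb.trans swapEmb = oddEmb := by
    ext n
    simp only [Function.Embedding.trans_apply, evenEmb_apply, oddEmb_apply, swapEmb_apply]
    split_ifs <;> omega
  have h2 : oddEmb.trans swapEmb = evenEmb := by
    ext n
    simp only [Function.Embedding.trans_apply, evenEmb_apply, oddEmb_apply, swapEmb_apply]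
    split_ifs <;> omega
  simp only [dsum, map_add, Stab.emb_emb, h1, h2]
  abel

variable (A) in
/-- The positive elements of `A ⊗ 𝒦`. -/
structure Pos where
  /-- The underlying element. -/
  val : Stab A
  /-- Positivity. -/
  pos : ∃ c : Stab A, val = star c * c

/-- Cuntz subequivalence as a preorder. -/
instance : Preorder (Pos A) where
  le a b := CuntzLE a.val b.val
  le_refl a := CuntzLE.refl a.val
  le_trans _ _ _ := CuntzLE.trans

theorem Pos.le_def (a b : Pos A) : a ≤ b ↔ CuntzLE a.val b.val := Iff.rfl

/-- The orthogonal sum of positive elements. -/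
def Pos.dsum (a b : Pos A) : Pos A := ⟨CuntzDiv.dsum a.val b.val, by
  obtain ⟨c, hc⟩ := a.pos
  obtain ⟨d, hd⟩ := b.pos
  exact ⟨CuntzDiv.dsum c d, by rw [star_dsum, dsum_mul, hc, hd]⟩⟩

variable (A) in
/-- The Cuntz semigroup `Cu(A)`: the Cuntz equivalence classes of positive elements in `A ⊗ 𝒦`,
where `a` and `b` are equivalent if `a ≾ b` and `b ≾ a`, ordered by Cuntz subequivalence. -/
def Cu : Type u := Antisymmetrization (Pos A) (· ≤ ·)

instance : PartialOrder (Cu A) :=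
  inferInstanceAs (PartialOrder (Antisymmetrization (Pos A) (· ≤ ·)))

/-- The Cuntz class `⟨a⟩` of a positive element. -/
def Cu.mk (a : Pos A) : Cu A := toAntisymmetrization (· ≤ ·) a

theorem Cu.mk_le_mk {a b : Pos A} : Cu.mk a ≤ Cu.mk b ↔ CuntzLE a.val b.val := Iff.rfl

theorem Cu.mk_eq_mk {a b : Pos A} : Cu.mk a = Cu.mk b ↔ CuntzLE a.val b.val ∧ CuntzLE b.val a.val := by
  rw [le_antisymm_iff, Cu.mk_le_mk, Cu.mk_le_mk]

theorem Cu.ind {p : Cu A → Prop} (h : ∀ a : Pos A, p (Cu.mk a)) (x : Cu A) : p x :=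
  Quotient.inductionOn' x h

instance : Zero (Cu A) := ⟨Cu.mk ⟨0, 0, by rw [mul_zero]⟩⟩

/-- The addition `⟨a⟩ + ⟨b⟩ = ⟨a ⊕ b⟩`. -/
instance : Add (Cu A) :=
  ⟨Quotient.map₂ Pos.dsum fun _ _ h _ _ h' => ⟨CuntzLE.dsum h.1 h'.1, CuntzLE.dsum h.2 h'.2⟩⟩

theorem Cu.mk_add_mk (a b : Pos A) : Cu.mk a + Cu.mk b = Cu.mk (Pos.dsum a b) := rfl

theorem Cu.zero_def : (0 : Cu A) = Cu.mk ⟨0, 0, by rw [mul_zero]⟩ := rfl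

theorem Cu.add_comm' (x y : Cu A) : x + y = y + x := by
  induction x using Cu.ind with | _ a
  induction y using Cu.ind with | _ b
  rw [Cu.mk_add_mk, Cu.mk_add_mk, Cu.mk_eq_mk]
  have h := emb_swapEmb_dsum a.val b.val
  constructor
  · have := emb_cuntzLE swapEmb (dsum a.val b.val)
    rwa [h] at this
  · have := cuntzLE_emb swapEmb (dsum a.val b.val)
    rwa [h] at this

theorem Cu.add_zero' (x : Cu A) : x + 0 = x := by
  induction x using Cu.ind with | _ a
  rw [Cu.zero_def, Cu.mk_add_mk, Cu.mk_eq_mk]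
  have h : dsum a.val 0 = Stab.emb evenEmb a.val := by rw [dsum, map_zero, add_zero]
  constructor
  · have := cuntzLE_emb evenEmb a.val
    rwa [← h] at this
  · have := emb_cuntzLE evenEmb a.val
    rwa [← h] at this

theorem Cu.add_assoc' (x y z : Cu A) : x + y + z = x + (y + z) := by
  induction x using Cu.ind with | _ a
  induction y using Cu.ind with | _ b
  induction z using Cu.ind with | _ c
  rw [Cu.mk_add_mk, Cu.mk_add_mk, Cu.mk_add_mk, Cu.mk_add_mk, Cu.mk_eq_mk]
  have h := emb_assocEmb_dsum a.val b.val c.val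
  constructor
  · have := emb_cuntzLE assocEmb (dsum (dsum a.val b.val) c.val)
    rwa [h] at this
  · have := cuntzLE_emb assocEmb (dsum (dsum a.val b.val) c.val)
    rwa [h] at this

instance : AddCommMonoid (Cu A) where
  add_assoc := Cu.add_assoc'
  zero_add x := (Cu.add_comm' 0 x).trans (Cu.add_zero' x)
  add_zero := Cu.add_zero'
  add_comm := Cu.add_comm'
  nsmul := nsmulRec

variable (A) in
/-- The projection `1 ⊗ e` in `A ⊗ 𝒦`, where `e` is the rank one projection onto the first basis
vector of `ℓ²(ℕ)`. -/
def unitMat : FinMat A :=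
  FinMat.mk (fun i j => if i = 0 ∧ j = 0 then 1 else 0) ⟨1, fun i j h => if_neg (by omega)⟩

theorem unitMat_apply (i j : ℕ) : unitMat A i j = if i = 0 ∧ j = 0 then 1 else 0 := rfl

theorem unitMat_eq : unitMat A = star (unitMat A) * unitMat A := by
  ext i j
  have hb : FinMat.Bdd 1 (unitMat A) := fun i j h => if_neg (by omega)
  rw [FinMat.mul_apply_right _ hb, Finset.sum_range_one, FinMat.star_apply]
  simp only [unitMat_apply]
  by_cases hi : i = 0 <;> by_cases hj : j = 0 <;> simp [hi, hj]

variable (A) in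
/-- The class `⟨1_A⟩` of the unit of `A`, where `A` is regarded as the corner `A ⊗ e` of
`A ⊗ 𝒦`. -/
def Cu.unit : Cu A := Cu.mk ⟨Stab.of (unitMat A), Stab.of (unitMat A), by
  rw [← Stab.of_star, ← Stab.of_mul, ← unitMat_eq]⟩

end CuntzSemigroup
section TensorOfClasses

open Finset

variable {A : Type u} {B : Type v} [CStarAlgebra A] [CStarAlgebra B]

theorem MinTensor.zero_tmul (b : B) : tmul (0 : A) b = 0 := by
  have h := MinTensor.smul_tmul (0 : ℂ) (0 : A) b
  rwa [zero_smul, zero_smul] at h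

theorem MinTensor.tmul_zero (a : A) : tmul a (0 : B) = 0 := by
  have h := MinTensor.tmul_smul (0 : ℂ) a (0 : B)
  rwa [zero_smul, zero_smul] at h

/-- The elementary tensor as a bilinear map. -/
def MinTensor.tmulₗ : A →ₗ[ℂ] B →ₗ[ℂ] MinTensor A B :=
  LinearMap.mk₂ ℂ MinTensor.tmul MinTensor.add_tmul MinTensor.smul_tmul MinTensor.tmul_add
    MinTensor.tmul_smul

theorem MinTensor.sum_tmul_sum {ι κ : Type*} (s : Finset ι) (t : Finset κ) (f : ι → A)
    (g : κ → B) : tmul (∑ i ∈ s, f i) (∑ k ∈ t, g k) = ∑ i ∈ s, ∑ k ∈ t, tmul (f i) (g k) := by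
  show tmulₗ (∑ i ∈ s, f i) (∑ k ∈ t, g k) = _
  have h : tmulₗ (∑ i ∈ s, f i) = ∑ i ∈ s, (tmulₗ (f i) : B →ₗ[ℂ] MinTensor A B) :=
    map_sum _ _ _
  rw [h, LinearMap.sum_apply]
  refine sum_congr rfl fun i _ => ?_
  exact map_sum _ _ _

namespace FinMat

theorem tensor_bdd {n : ℕ} {M : FinMat A} {N : FinMat B} (hM : Bdd n M) (hN : Bdd n N) (p q : ℕ)
    (h : n ^ 2 ≤ p ∨ n ^ 2 ≤ q) : MinTensor.tmul (M p.unpair.1 q.unpair.1)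
      (N p.unpair.2 q.unpair.2) = 0 := by
  have key : ∀ r : ℕ, n ^ 2 ≤ r → n ≤ r.unpair.1 ∨ n ≤ r.unpair.2 := by
    intro r hr
    by_contra hc
    push Not at hc
    have h1 := Nat.pair_lt_max_add_one_sq r.unpair.1 r.unpair.2
    rw [Nat.pair_unpair] at h1
    have h2 : max r.unpair.1 r.unpair.2 + 1 ≤ n := by omega
    have h3 := Nat.pow_le_pow_left h2 2
    omega
  rcases h with h | h
  · rcases key p h with h1 | h1
    · rw [hM _ _ (Or.inl h1), MinTensor.zero_tmul]
    · rw [hN _ _ (Or.inl h1), MinTensor.tmul_zero]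
  · rcases key q h with h1 | h1
    · rw [hM _ _ (Or.inr h1), MinTensor.zero_tmul]
    · rw [hN _ _ (Or.inr h1), MinTensor.tmul_zero]

/-- The tensor product of two matrices, with entry `M i j ⊗ N k l` at position
`((i, k), (j, l))`, where `ℕ × ℕ` is identified with `ℕ` by the pairing function. -/
def tensor (M : FinMat A) (N : FinMat B) : FinMat (MinTensor A B) :=
  mk (fun p q => MinTensor.tmul (M p.unpair.1 q.unpair.1) (N p.unpair.2 q.unpair.2)) <| by
    obtain ⟨m, hM⟩ := exists_bdd M
    obtain ⟨n, hN⟩ := exists_bdd N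
    exact ⟨(max m n) ^ 2, tensor_bdd (hM.mono (le_max_left m n)) (hN.mono (le_max_right m n))⟩

theorem tensor_apply (M : FinMat A) (N : FinMat B) (p q : ℕ) :
    tensor M N p q = MinTensor.tmul (M p.unpair.1 q.unpair.1) (N p.unpair.2 q.unpair.2) := rfl

theorem tensor_mul (M M' : FinMat A) (N N' : FinMat B) :
    tensor M N * tensor M' N' = tensor (M * M') (N * N') := by
  obtain ⟨m, hM⟩ := exists_bdd M
  obtain ⟨n, hN⟩ := exists_bdd N
  replace hM := hM.mono (le_max_left m n)
  replace hN := hN.mono (le_max_right m n)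
  set k := max m n
  have hb : Bdd (k ^ 2) (tensor M N) := tensor_bdd hM hN
  ext p r
  rw [mul_apply_left hb, tensor_apply, mul_apply_left hM, mul_apply_left hN,
    MinTensor.sum_tmul_sum, ← sum_product']
  symm
  have hsub : (range k ×ˢ range k).map Nat.pairEquiv.toEmbedding ⊆ range (k ^ 2) := by
    intro q hq
    obtain ⟨⟨i, j⟩, hij, rfl⟩ := mem_map.1 hq
    rw [mem_product, mem_range, mem_range] at hij
    rw [mem_range]
    have h1 := Nat.pair_lt_max_add_one_sq i j
    have h2 : max i j + 1 ≤ k := by omega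
    exact h1.trans_le (Nat.pow_le_pow_left h2 2)
  rw [← sum_subset hsub, sum_map]
  · refine sum_congr rfl fun x _ => ?_
    simp only [Equiv.coe_toEmbedding, Nat.pairEquiv_apply, tensor_apply, MinTensor.tmul_mul_tmul,
      Function.uncurry_def, Nat.unpair_pair]
  · intro q _ hq
    have hq' : k ≤ q.unpair.1 ∨ k ≤ q.unpair.2 := by
      by_contra hc
      push Not at hc
      refine hq (mem_map.2 ⟨q.unpair, ?_, ?_⟩)
      · rw [mem_product, mem_range, mem_range]
        exact hc
      · exact Nat.pair_unpair q
    rw [tensor_apply]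
    rcases hq' with h | h
    · rw [hM _ _ (Or.inr h), MinTensor.zero_tmul, zero_mul]
    · rw [hN _ _ (Or.inr h), MinTensor.tmul_zero, zero_mul]

theorem tensor_star (M : FinMat A) (N : FinMat B) :
    tensor (star M) (star N) = star (tensor M N) := by
  ext p q
  rw [star_apply, tensor_apply, tensor_apply, MinTensor.star_tmul, star_apply, star_apply]

theorem add_tensor (M M' : FinMat A) (N : FinMat B) :
    tensor (M + M') N = tensor M N + tensor M' N := by
  ext p q
  simp only [add_apply, tensor_apply, MinTensor.add_tmul]

theorem tensor_add (M : FinMat A) (N N' : FinMat B) :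
    tensor M (N + N') = tensor M N + tensor M N' := by
  ext p q
  simp only [add_apply, tensor_apply, MinTensor.tmul_add]

theorem smul_tensor (c : ℂ) (M : FinMat A) (N : FinMat B) :
    tensor (c • M) N = c • tensor M N := by
  ext p q
  simp only [smul_apply, tensor_apply, MinTensor.smul_tmul]

theorem tensor_smul (c : ℂ) (M : FinMat A) (N : FinMat B) :
    tensor M (c • N) = c • tensor M N := by
  ext p q
  simp only [smul_apply, tensor_apply, MinTensor.tmul_smul]

theorem norm_tensor_projection_right {P : FinMat B} (h1 : star P = P) (h2 : P * P = P)
    (M : FinMat A) : ‖tensor M P‖ ≤ ‖M‖ := by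
  let θ : FinMat A →⋆ₙₐ[ℂ] FinMat (MinTensor A B) :=
    { toFun := fun M => tensor M P
      map_smul' := fun c M => smul_tensor c M P
      map_zero' := by have := smul_tensor 0 (0 : FinMat A) P; rwa [zero_smul, zero_smul] at this
      map_add' := fun M N => add_tensor M N P
      map_mul' := fun M N => by rw [tensor_mul, h2]
      map_star' := fun M => by rw [← tensor_star, h1] }
  have h := norm_hom_le (Stab.ofHom.comp θ) M
  rw [← Stab.norm_of]
  exact h

theorem norm_tensor_projection_left {P : FinMat A} (h1 : star P = P) (h2 : P * P = P)
    (N : FinMat B) : ‖tensor P N‖ ≤ ‖N‖ := by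
  let θ : FinMat B →⋆ₙₐ[ℂ] FinMat (MinTensor A B) :=
    { toFun := fun N => tensor P N
      map_smul' := fun c N => tensor_smul c P N
      map_zero' := by have := tensor_smul 0 P (0 : FinMat B); rwa [zero_smul, zero_smul] at this
      map_add' := fun M N => tensor_add P M N
      map_mul' := fun M N => by rw [tensor_mul, h2]
      map_star' := fun M => by rw [← tensor_star, h1] }
  have h := norm_hom_le (Stab.ofHom.comp θ) N
  rw [← Stab.norm_of]
  exact h

theorem exists_projection (A : Type u) [CStarAlgebra A] (n : ℕ) : ∃ P : FinMat A, star P = P ∧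
    P * P = P ∧ ∀ M : FinMat A, Bdd n M → P * M = M ∧ M * P = M := by
  let f := Function.Embedding.refl ℕ
  refine ⟨star (shift f n) * shift f n, by rw [star_mul, star_star], ?_, fun M hM =>
    ⟨star_shift_mul_shift_mul f hM, mul_star_shift_mul_shift f hM⟩⟩
  refine star_shift_mul_shift_mul f fun i j h => ?_
  rw [star_shift_mul_shift_apply, if_neg (by omega)]

theorem norm_tensor_le (M : FinMat A) (N : FinMat B) : ‖tensor M N‖ ≤ ‖M‖ * ‖N‖ := by
  obtain ⟨m, hM⟩ := exists_bdd M
  obtain ⟨n, hN⟩ := exists_bdd N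
  obtain ⟨P, hP1, hP2, hP⟩ := exists_projection A m
  obtain ⟨Q, hQ1, hQ2, hQ⟩ := exists_projection B n
  have h : tensor M N = tensor M Q * tensor P N := by
    rw [tensor_mul, (hP M hM).2, (hQ N hN).1]
  rw [h]
  exact (norm_mul_le _ _).trans (mul_le_mul (norm_tensor_projection_right hQ1 hQ2 M)
    (norm_tensor_projection_left hP1 hP2 N) (norm_nonneg _) (norm_nonneg _))

/-- `tensor` as a bilinear map. -/
def tensorₗ : FinMat A →ₗ[ℂ] FinMat B →ₗ[ℂ] Stab (MinTensor A B) :=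
  LinearMap.mk₂ ℂ (fun M N => Stab.of (tensor M N))
    (fun M M' N => by rw [add_tensor, map_add]) (fun c M N => by rw [smul_tensor, map_smul])
    (fun M N N' => by rw [tensor_add, map_add]) (fun c M N => by rw [tensor_smul, map_smul])

end FinMat

namespace Stab

/-- The map `(a, b) ↦ a ⊗ b` from `(A ⊗ 𝒦) × (B ⊗ 𝒦)` to
`(A ⊗ 𝒦) ⊗ (B ⊗ 𝒦) = (A ⊗ B) ⊗ 𝒦`. -/
def tensorL : Stab A →L[ℂ] Stab B →L[ℂ] Stab (MinTensor A B) :=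
  bilinExt (LinearMap.mkContinuous₂ FinMat.tensorₗ 1 fun M N => by
    rw [one_mul]
    exact (norm_of _).trans_le (FinMat.norm_tensor_le M N))

theorem tensorL_of (M : FinMat A) (N : FinMat B) :
    tensorL (of M) (of N) = of (FinMat.tensor M N) :=
  bilinExt_coe (LinearMap.mkContinuous₂ FinMat.tensorₗ 1 fun M N => by
    rw [one_mul]
    exact (norm_of _).trans_le (FinMat.norm_tensor_le M N)) M N

theorem continuous_tensorL :
    Continuous fun z : Stab A × Stab B => (tensorL z.1 z.2 : Stab (MinTensor A B)) :=
  (tensorL (A := A) (B := B)).continuous₂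

theorem tensorL_mul (a a' : Stab A) (b b' : Stab B) :
    tensorL a b * tensorL a' b' = tensorL (a * a') (b * b') := by
  refine induction₂ (p := fun a b => tensorL a b * tensorL a' b' = tensorL (a * a') (b * b')) a b
    (isClosed_eq (continuous_tensorL.mul continuous_const) (continuous_tensorL.comp
      ((continuous_fst.mul continuous_const).prodMk (continuous_snd.mul continuous_const))))
    fun M N => ?_
  refine induction₂ (p := fun a' b' => tensorL (of M) (of N) * tensorL a' b'
      = tensorL (of M * a') (of N * b')) a' b'
    (isClosed_eq (continuous_const.mul continuous_tensorL) (continuous_tensorL.comp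
      ((continuous_const.mul continuous_fst).prodMk (continuous_const.mul continuous_snd))))
    fun M' N' => ?_
  rw [← of_mul, ← of_mul, tensorL_of, tensorL_of, tensorL_of, ← of_mul, FinMat.tensor_mul]

theorem tensorL_star (a : Stab A) (b : Stab B) :
    star (tensorL a b) = tensorL (star a) (star b) := by
  refine induction₂ (p := fun a b => star (tensorL a b) = tensorL (star a) (star b)) a b
    (isClosed_eq (continuous_star'.comp continuous_tensorL) (continuous_tensorL.comp
      ((continuous_star'.comp continuous_fst).prodMk (continuous_star'.comp continuous_snd))))
    fun M N => ?_
  rw [← of_star, ← of_star, tensorL_of, tensorL_of, ← of_star, FinMat.tensor_star]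

end Stab

theorem CuntzLE.tensor {a a' : Stab A} {b b' : Stab B} (ha : CuntzLE a a') (hb : CuntzLE b b') :
    CuntzLE (Stab.tensorL a b) (Stab.tensorL a' b') := by
  intro ε hε
  obtain ⟨δ, hδ, h⟩ := Metric.continuous_iff.1 (Stab.continuous_tensorL (A := A) (B := B)) (a, b)
    ε hε
  obtain ⟨d, hd⟩ := ha δ hδ
  obtain ⟨e, he⟩ := hb δ hδ
  refine ⟨Stab.tensorL d e, ?_⟩
  rw [Stab.tensorL_mul, Stab.tensorL_star, Stab.tensorL_mul, ← dist_eq_norm]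
  refine h (d * a' * star d, e * b' * star e) ?_
  rw [Prod.dist_eq, max_lt_iff, dist_eq_norm, dist_eq_norm]
  exact ⟨hd, he⟩

/-- The tensor product of positive elements. -/
def Pos.tensor (a : Pos A) (b : Pos B) : Pos (MinTensor A B) where
  val := Stab.tensorL a.val b.val
  pos := by
    obtain ⟨c, hc⟩ := a.pos
    obtain ⟨d, hd⟩ := b.pos
    exact ⟨Stab.tensorL c d, by rw [Stab.tensorL_star, Stab.tensorL_mul, hc, hd]⟩

/-- The natural map `Cu(A) × Cu(B) → Cu(A ⊗ B)`, `⟨a⟩ ⊗ ⟨b⟩ = ⟨a ⊗ b⟩`. -/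
def Cu.tensor : Cu A → Cu B → Cu (MinTensor A B) :=
  Quotient.map₂ Pos.tensor fun _ _ h _ _ h' =>
    ⟨CuntzLE.tensor h.1 h'.1, CuntzLE.tensor h.2 h'.2⟩

theorem Cu.mk_tensor_mk (a : Pos A) (b : Pos B) :
    Cu.tensor (Cu.mk a) (Cu.mk b) = Cu.mk (Pos.tensor a b) := rfl

end TensorOfClasses

section Divisibility

/-- The relation `u ≪ v`: whenever `v` is the supremum of an increasing sequence `(vᵢ)`, then
`u ≤ vᵢ` for some `i`. -/
def WayBelow {S : Type u} [PartialOrder S] (u v : S) : Prop :=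
  ∀ w : ℕ → S, Monotone w → IsLUB (Set.range w) v → ∃ i, u ≤ w i

variable {A : Type u} [CStarAlgebra A]

/-- `(m, n)`-divisibility of an element of `Cu(A)`. -/
def Cu.Divisible (m n : ℕ) (u : Cu A) : Prop :=
  ∀ u' : Cu A, WayBelow u' u → ∃ x : Cu A, m • x ≤ u ∧ u' ≤ n • x

/-- `(m, n)`-decomposability of an element of `Cu(A)`. -/
def Cu.Decomposable (m n : ℕ) (u : Cu A) : Prop :=
  ∀ u' : Cu A, WayBelow u' u → ∃ x : Fin m → Cu A, ∑ j, x j ≤ u ∧ ∀ j, u' ≤ n • x j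

/-- Weak `(m, n)`-divisibility of an element of `Cu(A)`. -/
def Cu.WeaklyDivisible (m n : ℕ) (u : Cu A) : Prop :=
  ∀ u' : Cu A, WayBelow u' u → ∃ x : Fin n → Cu A, (∀ j, m • x j ≤ u) ∧ u' ≤ ∑ j, x j

end Divisibility

section AlgebraDivisibility

variable (m n : ℕ) (B : Type v) [CStarAlgebra B]

/-- The unital C*-algebra `B` is `(m, n)`-divisible if `⟨1_B⟩` is. -/
def IsDivisible : Prop := Cu.Divisible m n (Cu.unit B)

/-- The unital C*-algebra `B` is `(m, n)`-decomposable if `⟨1_B⟩` is. -/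
def IsDecomposable : Prop := Cu.Decomposable m n (Cu.unit B)

/-- The unital C*-algebra `B` is weakly `(m, n)`-divisible if `⟨1_B⟩` is. -/
def IsWeaklyDivisible : Prop := Cu.WeaklyDivisible m n (Cu.unit B)

end AlgebraDivisibility

end CuntzDiv

end

/-!
The class of `1_B` is the class of a projection, and classes of projections are compact:
`⟨1_B⟩ ≪ ⟨1_B⟩`. Each divisibility property therefore applies with `u' = ⟨1_B⟩`, and the
conclusions follow by moving multiples and sums across the monotone biadditive map
`(x, y) ↦ x ⊗ y`.

For compactness, let `⟨p⟩` be the supremum of an increasing sequence `⟨a_i⟩`. The order of `Cu`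
alone says nothing about approximating `p`, so one constructs an upper bound `c` of the sequence
that is a limit of conjugates `d a_i d*`. First `(a_i)` is replaced by an equivalent sequence with
`b_k = x_k b_{k+1} x_k*` exactly, each `x_k` being a finite matrix. Infinitely many orthogonal
copies of `x_k x_{k+1} ⋯`, weighted by small scalars `r_k ≠ 0`, are then placed in one row, and
`c` is the limit of the conjugates of the `b_k` by these rows; cutting down to the `k`-th copy
recovers `b_k`. Since `⟨p⟩ ≤ ⟨c⟩`, the projection `p` is within `1/2` of some `d a_i d*`, and Newton
iteration for the inverse square root in the corner of `p` gives `⟨p⟩ ≤ ⟨a_i⟩`.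
-/

namespace CuntzDiv

section OrderedMonoid

variable {A : Type u} [CStarAlgebra A]

instance : IsOrderedAddMonoid (Cu A) where
  add_le_add_left x y hxy z := by
    induction x using Cu.ind with | _ a
    induction y using Cu.ind with | _ b
    induction z using Cu.ind with | _ c
    exact CuntzLE.dsum hxy (CuntzLE.refl c.val)

theorem Cu.mk_surjective : Function.Surjective (Cu.mk : Pos A → Cu A) :=
  Cu.ind fun a => ⟨a, rfl⟩

end OrderedMonoid

section OrthogonalSums

variable {A : Type u} [CStarAlgebra A]

theorem Stab.emb_refl (a : Stab A) : emb (.refl ℕ) a = a := by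
  refine induction₁ (p := fun a => emb (.refl ℕ) a = a) a
    (isClosed_eq (continuous_emb _) continuous_id) fun M => ?_
  rw [emb_of]
  congr 1
  ext i j
  exact FinMat.embFun_apply (.refl ℕ) M i j

/-- The embedding acting by `f` on the even numbers and by `g` on the odd numbers. -/
def joinEmb (f g : ℕ ↪ ℕ) (h : ∀ i j, f i ≠ g j) : ℕ ↪ ℕ :=
  Equiv.natSumNatEquivNat.symm.toEmbedding.trans
    ⟨Sum.elim f g, f.injective.sumElim g.injective h⟩

theorem evenEmb_trans_joinEmb (f g : ℕ ↪ ℕ) (h : ∀ i j, f i ≠ g j) :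
    evenEmb.trans (joinEmb f g h) = f := by
  ext n
  exact congrArg (Sum.elim f g) (Equiv.natSumNatEquivNat.symm_apply_apply (.inl n))

theorem oddEmb_trans_joinEmb (f g : ℕ ↪ ℕ) (h : ∀ i j, f i ≠ g j) :
    oddEmb.trans (joinEmb f g h) = g := by
  ext n
  exact congrArg (Sum.elim f g) (Equiv.natSumNatEquivNat.symm_apply_apply (.inr n))

theorem emb_joinEmb_dsum (f g : ℕ ↪ ℕ) (h : ∀ i j, f i ≠ g j) (a b : Stab A) :
    Stab.emb (joinEmb f g h) (dsum a b) = Stab.emb f a + Stab.emb g b := by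
  simp only [dsum, map_add, Stab.emb_emb, evenEmb_trans_joinEmb, oddEmb_trans_joinEmb]

theorem Cu.mk_eq_add_of_eq_emb_add_emb {a b c : Pos A} {f g : ℕ ↪ ℕ} (hfg : ∀ i j, f i ≠ g j)
    (hc : c.val = Stab.emb f a.val + Stab.emb g b.val) : mk c = mk a + mk b := by
  rw [← emb_joinEmb_dsum f g hfg] at hc
  rw [mk_add_mk, mk_eq_mk, hc]
  exact ⟨cuntzLE_emb _ _, emb_cuntzLE _ _⟩

end OrthogonalSums

section TensorAdditive

variable {A : Type u} {B : Type v} [CStarAlgebra A] [CStarAlgebra B]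

/-- The embedding of `ℕ ≃ ℕ × ℕ` acting by `f` on the first and by `g` on the second factor. -/
def pairEmb (f g : ℕ ↪ ℕ) : ℕ ↪ ℕ :=
  Nat.pairEquiv.symm.toEmbedding.trans ((f.prodMap g).trans Nat.pairEquiv.toEmbedding)

theorem pairEmb_apply (f g : ℕ ↪ ℕ) (n : ℕ) :
    pairEmb f g n = Nat.pair (f n.unpair.1) (g n.unpair.2) := rfl

theorem exists_pairEmb_eq {f g : ℕ ↪ ℕ} {p : ℕ} (hf : ∃ i, f i = p.unpair.1)
    (hg : ∃ j, g j = p.unpair.2) : ∃ k, pairEmb f g k = p := by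
  obtain ⟨⟨i, hi⟩, ⟨j, hj⟩⟩ := And.intro hf hg
  exact ⟨Nat.pair i j, by rw [pairEmb_apply, Nat.unpair_pair, hi, hj, Nat.pair_unpair]⟩

theorem FinMat.tensor_emb_emb (f g : ℕ ↪ ℕ) (M : FinMat A) (N : FinMat B) :
    tensor (emb f M) (emb g N) = emb (pairEmb f g) (tensor M N) := by
  have factor_missed {p : ℕ} (hp : ¬ ∃ k, pairEmb f g k = p) :
      (¬ ∃ i, f i = p.unpair.1) ∨ ¬ ∃ j, g j = p.unpair.2 := by
    by_contra! hc
    exact hp (exists_pairEmb_eq hc.1 hc.2)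
  simp only [emb_eq]
  refine ext_range (pairEmb f g) (fun i k => ?_) (fun p q hp => ?_) (fun p q hq => ?_)
  · rw [embFun_apply, tensor_apply, tensor_apply]
    simp only [pairEmb_apply, Nat.unpair_pair, embFun_apply]
  · rw [embFun_apply_left _ _ q hp, tensor_apply]
    rcases factor_missed hp with h | h
    · rw [embFun_apply_left _ _ _ h, MinTensor.zero_tmul]
    · rw [embFun_apply_left _ _ _ h, MinTensor.tmul_zero]
  · rw [embFun_apply_right _ _ p hq, tensor_apply]
    rcases factor_missed hq with h | h
    · rw [embFun_apply_right _ _ _ h, MinTensor.zero_tmul]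
    · rw [embFun_apply_right _ _ _ h, MinTensor.tmul_zero]

theorem Stab.tensorL_emb_emb (f g : ℕ ↪ ℕ) (a : Stab A) (b : Stab B) :
    tensorL (emb f a) (emb g b) = emb (pairEmb f g) (tensorL a b) := by
  refine induction₂ (p := fun a b => tensorL (emb f a) (emb g b)
      = emb (pairEmb f g) (tensorL a b)) a b
    (isClosed_eq (continuous_tensorL.comp (((continuous_emb f).comp continuous_fst).prodMk
      ((continuous_emb g).comp continuous_snd))) ((continuous_emb _).comp continuous_tensorL))
    fun M N => ?_
  rw [emb_of, emb_of, tensorL_of, tensorL_of, emb_of, FinMat.tensor_emb_emb]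

theorem Stab.tensorL_emb_left (f : ℕ ↪ ℕ) (a : Stab A) (b : Stab B) :
    tensorL (emb f a) b = emb (pairEmb f (.refl ℕ)) (tensorL a b) := by
  rw [← tensorL_emb_emb, emb_refl]

theorem Stab.tensorL_emb_right (f : ℕ ↪ ℕ) (a : Stab A) (b : Stab B) :
    tensorL a (emb f b) = emb (pairEmb (.refl ℕ) f) (tensorL a b) := by
  rw [← tensorL_emb_emb, emb_refl]

theorem Cu.add_tensor (x y : Cu A) (z : Cu B) : tensor (x + y) z = tensor x z + tensor y z := by
  induction x using Cu.ind with | _ a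
  induction y using Cu.ind with | _ b
  induction z using Cu.ind with | _ c
  refine mk_eq_add_of_eq_emb_add_emb (f := pairEmb evenEmb (.refl ℕ))
    (g := pairEmb oddEmb (.refl ℕ)) (fun i j h => ?_) ?_
  · exact evenEmb_ne_oddEmb _ _ (Nat.pair_eq_pair.1 h).1
  · change Stab.tensorL (dsum a.val b.val) c.val = _
    rw [dsum, map_add, _root_.add_apply, Stab.tensorL_emb_left, Stab.tensorL_emb_left]
    rfl

theorem Cu.tensor_add (x : Cu A) (y z : Cu B) : tensor x (y + z) = tensor x y + tensor x z := by
  induction x using Cu.ind with | _ a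
  induction y using Cu.ind with | _ b
  induction z using Cu.ind with | _ c
  refine mk_eq_add_of_eq_emb_add_emb (f := pairEmb (.refl ℕ) evenEmb)
    (g := pairEmb (.refl ℕ) oddEmb) (fun i j h => ?_) ?_
  · exact evenEmb_ne_oddEmb _ _ (Nat.pair_eq_pair.1 h).2
  · change Stab.tensorL a.val (dsum b.val c.val) = _
    rw [dsum, map_add, Stab.tensorL_emb_right, Stab.tensorL_emb_right]
    rfl

theorem Cu.zero_tensor (z : Cu B) : tensor (0 : Cu A) z = 0 := by
  induction z using Cu.ind with | _ c
  refine congrArg Cu.mk ?_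
  simp only [Pos.tensor, map_zero, _root_.zero_apply]

theorem Cu.tensor_zero (x : Cu A) : tensor x (0 : Cu B) = 0 := by
  induction x using Cu.ind with | _ a
  refine congrArg Cu.mk ?_
  simp only [Pos.tensor, map_zero]

theorem Cu.tensor_mono {x x' : Cu A} {y y' : Cu B} (hx : x ≤ x') (hy : y ≤ y') :
    tensor x y ≤ tensor x' y' := by
  induction x using Cu.ind with | _ a
  induction x' using Cu.ind with | _ a'
  induction y using Cu.ind with | _ b
  induction y' using Cu.ind with | _ b'
  exact CuntzLE.tensor hx hy

/-- The additive map `x ↦ x ⊗ z`. -/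
noncomputable def Cu.tensorRight (z : Cu B) : Cu A →+ Cu (MinTensor A B) where
  toFun x := tensor x z
  map_zero' := zero_tensor z
  map_add' x y := add_tensor x y z

/-- The additive map `z ↦ x ⊗ z`. -/
noncomputable def Cu.tensorLeft (x : Cu A) : Cu B →+ Cu (MinTensor A B) where
  toFun := tensor x
  map_zero' := tensor_zero x
  map_add' := tensor_add x

theorem Cu.tensor_nsmul_eq_nsmul_tensor (n : ℕ) (x : Cu A) (z : Cu B) :
    tensor x (n • z) = tensor (n • x) z :=
  (map_nsmul (tensorLeft x) n z).trans (map_nsmul (tensorRight z) n x).symm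

theorem Cu.sum_tensor {ι : Type*} (s : Finset ι) (x : ι → Cu A) (z : Cu B) :
    tensor (∑ i ∈ s, x i) z = ∑ i ∈ s, tensor (x i) z :=
  map_sum (tensorRight z) x s

theorem Cu.tensor_sum {ι : Type*} (s : Finset ι) (x : Cu A) (z : ι → Cu B) :
    tensor x (∑ i ∈ s, z i) = ∑ i ∈ s, tensor x (z i) :=
  map_sum (tensorLeft x) z s

end TensorAdditive

section TensorDivisibility

variable {A : Type u} {B : Type v} [CStarAlgebra A] [CStarAlgebra B] {m n : ℕ} {u u' : Cu B}

theorem Cu.Divisible.tensor_le_tensor (hu : Divisible m n u) (hu' : WayBelow u' u) {x y : Cu A}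
    (hxy : n • x ≤ m • y) : tensor x u' ≤ tensor y u := by
  obtain ⟨z, hzu, huz⟩ := hu u' hu'
  calc tensor x u' ≤ tensor x (n • z) := tensor_mono le_rfl huz
    _ = tensor (n • x) z := tensor_nsmul_eq_nsmul_tensor n x z
    _ ≤ tensor (m • y) z := tensor_mono hxy le_rfl
    _ = tensor y (m • z) := (tensor_nsmul_eq_nsmul_tensor m y z).symm
    _ ≤ tensor y u := tensor_mono le_rfl hzu

theorem Cu.Decomposable.sum_tensor_le_tensor (hu : Decomposable m n u) (hu' : WayBelow u' u)
    {x : Fin m → Cu A} {y : Cu A} (hxy : ∀ j, n • x j ≤ y) :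
    tensor (∑ j, x j) u' ≤ tensor y u := by
  obtain ⟨z, hzu, huz⟩ := hu u' hu'
  calc tensor (∑ j, x j) u' = ∑ j, tensor (x j) u' := sum_tensor _ _ _
    _ ≤ ∑ j, tensor (x j) (n • z j) := Finset.sum_le_sum fun j _ => tensor_mono le_rfl (huz j)
    _ = ∑ j, tensor (n • x j) (z j) := by simp only [tensor_nsmul_eq_nsmul_tensor]
    _ ≤ ∑ j, tensor y (z j) := Finset.sum_le_sum fun j _ => tensor_mono (hxy j) le_rfl
    _ = tensor y (∑ j, z j) := (tensor_sum _ _ _).symm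
    _ ≤ tensor y u := tensor_mono le_rfl hzu

theorem Cu.WeaklyDivisible.tensor_le_sum_tensor (hu : WeaklyDivisible m n u)
    (hu' : WayBelow u' u) {x : Cu A} {y : Fin n → Cu A} (hxy : ∀ j, x ≤ m • y j) :
    tensor x u' ≤ tensor (∑ j, y j) u := by
  obtain ⟨z, hzu, huz⟩ := hu u' hu'
  calc tensor x u' ≤ tensor x (∑ j, z j) := tensor_mono le_rfl huz
    _ = ∑ j, tensor x (z j) := tensor_sum _ _ _
    _ ≤ ∑ j, tensor (m • y j) (z j) := Finset.sum_le_sum fun j _ => tensor_mono (hxy j) le_rfl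
    _ = ∑ j, tensor (y j) (m • z j) := by simp only [tensor_nsmul_eq_nsmul_tensor]
    _ ≤ ∑ j, tensor (y j) u := Finset.sum_le_sum fun j _ => tensor_mono le_rfl (hzu j)
    _ = tensor (∑ j, y j) u := (sum_tensor _ _ _).symm

end TensorDivisibility

section ConjugationClosure

theorem conj_sub {D : Type*} [NonUnitalRing D] [Star D] (d s t : D) :
    d * (s - t) * star d = d * s * star d - d * t * star d := by
  rw [mul_sub, sub_mul]

theorem conj_conj {D : Type*} [Semigroup D] [StarMul D] (d e t : D) :
    d * (e * t * star e) * star d = d * e * t * star (d * e) := by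
  simp only [star_mul, mul_assoc]

theorem norm_conj_le {D : Type*} [NonUnitalNormedRing D] [StarRing D] [NormedStarGroup D]
    (d t : D) : ‖d * t * star d‖ ≤ ‖d‖ ^ 2 * ‖t‖ := by
  calc ‖d * t * star d‖ ≤ ‖d‖ * ‖t‖ * ‖star d‖ := norm_mul₃_le
    _ = ‖d‖ ^ 2 * ‖t‖ := by rw [norm_star]; ring

section Topological

open Filter Topology

variable {D : Type*} [TopologicalSpace D] [Semigroup D] [StarMul D]

/-- The closure of the set of conjugates `d s d*` with `s ∈ S`. For positive elements of a
C⋆-algebra, `a ∈ conjClosure {b}` is Cuntz subequivalence of `a` to `b`. -/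
def conjClosure (S : Set D) : Set D :=
  closure {t | ∃ s ∈ S, ∃ d, d * s * star d = t}

theorem mem_conjClosure_range_of_tendsto {b d : ℕ → D} {a : D}
    (h : Tendsto (fun n => d n * b n * star (d n)) atTop (𝓝 a)) :
    a ∈ conjClosure (Set.range b) :=
  mem_closure_of_tendsto h (.of_forall fun n => ⟨b n, ⟨n, rfl⟩, d n, rfl⟩)

variable [ContinuousMul D]

theorem continuous_conj (d : D) : Continuous fun t => d * t * star d := by
  fun_prop

theorem conj_mem_conjClosure {S : Set D} {t : D} (ht : t ∈ conjClosure S) (d : D) :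
    d * t * star d ∈ conjClosure S := by
  refine map_mem_closure (f := fun t => d * t * star d) (continuous_conj d) ht ?_
  rintro _ ⟨s, hs, e, rfl⟩
  exact ⟨s, hs, d * e, (conj_conj d e s).symm⟩

theorem conjClosure_subset {S T : Set D} (h : S ⊆ conjClosure T) :
    conjClosure S ⊆ conjClosure T := by
  refine closure_minimal ?_ isClosed_closure
  rintro _ ⟨s, hs, d, rfl⟩
  exact conj_mem_conjClosure (h hs) d

end Topological

variable {D : Type*} [NonUnitalCStarAlgebra D]

variable (D) in
theorem isClosed_setOf_eq_star_mul_self : IsClosed {a : D | ∃ c, a = star c * c} := by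
  let _ := CStarAlgebra.spectralOrder D
  have := CStarAlgebra.spectralOrderedRing D
  simp only [← CStarAlgebra.nonneg_iff_eq_star_mul_self]
  exact CStarAlgebra.isClosed_nonneg

theorem exists_eq_star_mul_self_of_mem_conjClosure {S : Set D} {t : D} (ht : t ∈ conjClosure S)
    (hS : ∀ s ∈ S, ∃ c, s = star c * c) : ∃ c, t = star c * c := by
  refine closure_minimal ?_ (isClosed_setOf_eq_star_mul_self D) ht
  rintro _ ⟨s, hs, d, rfl⟩
  obtain ⟨c, rfl⟩ := hS s hs
  exact ⟨c * star d, by simp only [star_mul, star_star, mul_assoc]⟩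

end ConjugationClosure

section Projections

variable {D : Type*}

/-- A Newton step for the inverse square root: if `z = p - 2s`, then the next error is of order
`‖s‖²`, since `(p + s) z (p + s) = p - 3s² - 2s³`. -/
theorem norm_newton_sub_le [NonUnitalSeminormedRing D] {p s : D} (hpp : p * p = p) (hps : p * s = s)
    (hsp : s * p = s) (hs : ‖s‖ ≤ 1 / 4) :
    ‖(p + s) * (p - (s + s)) * (p + s) - p‖ ≤ ‖s‖ := by
  have expand : (p + s) * (p - (s + s)) * (p + s) - p = -(3 • (s * s) + 2 • (s * s * s)) := by
    simp only [add_mul, mul_add, mul_sub, sub_mul, hpp, hps, hsp, mul_assoc]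
    abel
  have norm_sq : ‖s * s‖ ≤ 1 / 4 * ‖s‖ := (norm_mul_le s s).trans (by gcongr)
  have norm_cube : ‖s * s * s‖ ≤ 1 / 4 * (1 / 4) * ‖s‖ := norm_mul₃_le.trans (by gcongr)
  calc ‖(p + s) * (p - (s + s)) * (p + s) - p‖ = ‖3 • (s * s) + 2 • (s * s * s)‖ := by
        rw [expand, norm_neg]
    _ ≤ 3 * ‖s * s‖ + 2 * ‖s * s * s‖ :=
        norm_add_le_of_le norm_nsmul_le norm_nsmul_le
    _ ≤ ‖s‖ := by linarith [norm_nonneg s]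

variable [NonUnitalCStarAlgebra D] {p a : D}

theorem exists_norm_conj_sub_projection_le_half {e : D} (hp : IsStarProjection p)
    (ha : IsSelfAdjoint a) (hpe : p * e = e) (he : ‖e * a * star e - p‖ ≤ 1 / 2) :
    ∃ e', p * e' = e' ∧ ‖e' * a * star e' - p‖ ≤ ‖e * a * star e - p‖ / 2 := by
  have hpp : p * p = p := hp.isIdempotentElem
  set s : D := (1 / 2 : ℂ) • (p - e * a * star e) with hs
  have hz : e * a * star e = p - (s + s) := by
    rw [hs, ← add_smul]
    norm_num
  have hs_star : star s = s := by
    rw [hs, star_smul, (hp.isSelfAdjoint.sub (ha.conjugate e)).star_eq]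
    simp
  have hps : p * s = s := by
    rw [hs, mul_smul_comm, mul_sub, hpp, ← mul_assoc, ← mul_assoc, hpe]
  have hsp : s * p = s := by
    simpa only [star_mul, hs_star, hp.isSelfAdjoint.star_eq] using congrArg star hps
  have hs_norm : ‖s‖ = ‖e * a * star e - p‖ / 2 := by
    rw [hs, norm_smul, norm_sub_rev]
    norm_num
    ring
  refine ⟨(p + s) * e, by rw [← mul_assoc, mul_add, hpp, hps], ?_⟩
  rw [← conj_conj, hz, star_add, hp.isSelfAdjoint.star_eq, hs_star, ← hz, ← hs_norm, hz]
  exact norm_newton_sub_le hpp hps hsp (by linarith)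

theorem mem_conjClosure_of_norm_conj_sub_projection_le {d : D} (hp : IsStarProjection p)
    (ha : IsSelfAdjoint a) (hd : ‖d * a * star d - p‖ ≤ 1 / 2) : p ∈ conjClosure {a} := by
  have hpp : p * p = p := hp.isIdempotentElem
  have approx (n : ℕ) : ∃ e, p * e = e ∧ ‖e * a * star e - p‖ ≤ (1 / 2) ^ (n + 1) := by
    induction n with
    | zero =>
      refine ⟨p * d, by rw [← mul_assoc, hpp], ?_⟩
      have compress : p * d * a * star (p * d) - p = p * (d * a * star d - p) * star p := by
        rw [conj_sub, conj_conj, hp.isSelfAdjoint.star_eq, hpp, hpp]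
      calc ‖p * d * a * star (p * d) - p‖ ≤ ‖p‖ ^ 2 * ‖d * a * star d - p‖ :=
            compress ▸ norm_conj_le _ _
        _ ≤ 1 ^ 2 * (1 / 2) := by
            gcongr
            exact hp.norm_le
        _ = (1 / 2) ^ (0 + 1) := by norm_num
    | succ n ih =>
      obtain ⟨e, hpe, he⟩ := ih
      have he_half : ‖e * a * star e - p‖ ≤ 1 / 2 :=
        he.trans (pow_le_of_le_one (by norm_num) (by norm_num) n.succ_ne_zero)
      obtain ⟨e', hpe', he'⟩ := exists_norm_conj_sub_projection_le_half hp ha hpe he_half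
      refine ⟨e', hpe', he'.trans ?_⟩
      rw [pow_succ]
      linarith
  refine Metric.mem_closure_iff.2 fun ε hε => ?_
  obtain ⟨n, hn⟩ := exists_pow_lt_of_lt_one hε (by norm_num : (1 / 2 : ℝ) < 1)
  obtain ⟨e, -, he⟩ := approx n
  refine ⟨_, ⟨a, rfl, e, rfl⟩, ?_⟩
  rw [dist_comm, dist_eq_norm]
  exact he.trans_lt ((pow_le_pow_of_le_one (by norm_num) (by norm_num) n.le_succ).trans_lt hn)

end Projections

section ExactConjugates

open Filter Topology

section IteratedConjugates

variable {D : Type*} [Semigroup D] [StarMul D]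

/-- The iterated conjugate `x_j ⋯ x_{j+n-1} a_{j+n} (x_j ⋯ x_{j+n-1})*`. -/
def iterConj (x a : ℕ → D) : ℕ → ℕ → D
  | 0, j => a j
  | n + 1, j => x j * iterConj x a n (j + 1) * star (x j)

theorem exists_conj_eq_iterConj_succ (x a : ℕ → D) (n j : ℕ) :
    ∃ d, d * a (j + n + 1) * star d = iterConj x a (n + 1) j := by
  induction n generalizing j with
  | zero => exact ⟨x j, rfl⟩
  | succ n ih =>
    obtain ⟨d, hd⟩ := ih (j + 1)
    refine ⟨x j * d, ?_⟩
    rw [iterConj, ← hd, conj_conj, add_right_comm j 1 n, ← add_assoc]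

end IteratedConjugates

variable {D : Type*} [NonUnitalCStarAlgebra D]

section Weights

variable {x a : ℕ → D} {Q : ℕ → ℝ}

theorem mul_norm_iterConj_succ_sub_le (hQ : ∀ k, 0 ≤ Q k)
    (hQx : ∀ k, Q k * ‖x k‖ ^ 2 ≤ Q (k + 1))
    (ha : ∀ k, Q k * ‖x k * a (k + 1) * star (x k) - a k‖ ≤ (1 / 2) ^ k) (n j : ℕ) :
    Q j * ‖iterConj x a (n + 1) j - iterConj x a n j‖ ≤ (1 / 2) ^ (j + n) := by
  induction n generalizing j with
  | zero => exact ha j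
  | succ n ih =>
    change Q j * ‖x j * iterConj x a (n + 1) (j + 1) * star (x j)
      - x j * iterConj x a n (j + 1) * star (x j)‖ ≤ _
    rw [← conj_sub]
    set t := iterConj x a (n + 1) (j + 1) - iterConj x a n (j + 1)
    calc Q j * ‖x j * t * star (x j)‖
        ≤ Q j * (‖x j‖ ^ 2 * ‖t‖) := mul_le_mul_of_nonneg_left (norm_conj_le _ _) (hQ j)
      _ = Q j * ‖x j‖ ^ 2 * ‖t‖ := by ring
      _ ≤ Q (j + 1) * ‖t‖ := mul_le_mul_of_nonneg_right (hQx j) (norm_nonneg _)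
      _ ≤ (1 / 2) ^ (j + 1 + n) := ih (j + 1)
      _ = (1 / 2) ^ (j + (n + 1)) := by rw [add_right_comm, add_assoc]

theorem exists_tendsto_iterConj (hQ : ∀ k, 0 < Q k) (hQx : ∀ k, Q k * ‖x k‖ ^ 2 ≤ Q (k + 1))
    (ha : ∀ k, Q k * ‖x k * a (k + 1) * star (x k) - a k‖ ≤ (1 / 2) ^ k) (j : ℕ) :
    ∃ b, Tendsto (fun n => iterConj x a n j) atTop (𝓝 b) ∧ Q j * ‖b - a j‖ ≤ 2 * (1 / 2) ^ j := by
  have geometric (n : ℕ) : dist (iterConj x a n j) (iterConj x a (n + 1) j)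
      ≤ (1 / 2) ^ j / Q j * (1 / 2) ^ n := by
    rw [dist_comm, dist_eq_norm, div_mul_eq_mul_div, le_div_iff₀ (hQ j), ← pow_add, mul_comm]
    exact mul_norm_iterConj_succ_sub_le (fun k => (hQ k).le) hQx ha n j
  obtain ⟨b, hb⟩ := cauchySeq_tendsto_of_complete
    (cauchySeq_of_le_geometric _ _ (by norm_num) geometric)
  refine ⟨b, hb, ?_⟩
  have hdist : ‖b - a j‖ ≤ (1 / 2) ^ j / Q j / (1 - 1 / 2) := by
    rw [← dist_eq_norm, dist_comm]
    exact dist_le_of_le_geometric_of_tendsto₀ _ _ (by norm_num) geometric hb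
  calc Q j * ‖b - a j‖ ≤ Q j * ((1 / 2) ^ j / Q j / (1 - 1 / 2)) :=
        mul_le_mul_of_nonneg_left hdist (hQ j).le
    _ = 2 * (1 / 2) ^ j := by
        have := (hQ j).ne'
        field_simp
        norm_num

theorem exists_weighted_conj_approx {S : Set D}
    (ha : ∀ k, ∀ ε : ℝ, 0 < ε → ∃ d ∈ S, ‖d * a (k + 1) * star d - a k‖ < ε) {E : ℕ → ℝ}
    (hE : ∀ k, 0 ≤ E k) :
    ∃ (x : ℕ → D) (Q : ℕ → ℝ), (∀ k, x k ∈ S) ∧ (∀ k, 0 < Q k) ∧ (∀ k, E k ≤ Q k) ∧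
      (∀ k, Q k * ‖x k‖ ^ 2 ≤ Q (k + 1)) ∧
      ∀ k, Q k * ‖x k * a (k + 1) * star (x k) - a k‖ ≤ (1 / 2) ^ k := by
  choose! X hXS hX using ha
  let Q : ℕ → ℝ := Nat.rec (1 + E 0) fun k q => q * (1 + ‖X k ((1 / 2) ^ k / q)‖ ^ 2) + E (k + 1)
  let x (k : ℕ) : D := X k ((1 / 2) ^ k / Q k)
  have hQ_succ (k : ℕ) : Q (k + 1) = Q k * (1 + ‖x k‖ ^ 2) + E (k + 1) := rfl
  have hQ_pos (k : ℕ) : 0 < Q k := by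
    induction k with
    | zero => exact add_pos_of_pos_of_nonneg one_pos (hE 0)
    | succ k ih => exact add_pos_of_pos_of_nonneg (by positivity) (hE (k + 1))
  have tolerance_pos (k : ℕ) : 0 < (1 / 2) ^ k / Q k := div_pos (by positivity) (hQ_pos k)
  refine ⟨x, Q, fun k => hXS k _ (tolerance_pos k), hQ_pos, fun k => ?_, fun k => ?_, fun k => ?_⟩
  · cases k with
    | zero => exact le_add_of_nonneg_left zero_le_one
    | succ k =>
      have := hQ_pos k
      exact le_add_of_nonneg_left (by positivity)
  · rw [hQ_succ]
    linarith [hQ_pos k, hE (k + 1)]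
  · rw [mul_comm, ← le_div_iff₀ (hQ_pos k)]
    exact (hX k _ (tolerance_pos k)).le

end Weights

theorem exists_exact_conj_sequence {S : Set D} {a : ℕ → D}
    (ha : ∀ i j, i ≤ j → ∀ ε : ℝ, 0 < ε → ∃ d ∈ S, ‖d * a j * star d - a i‖ < ε) :
    ∃ x b : ℕ → D, (∀ k, x k ∈ S) ∧ (∀ k, b k = x k * b (k + 1) * star (x k)) ∧
      Set.range a ⊆ conjClosure (Set.range b) ∧ Set.range b ⊆ conjClosure (Set.range a) := by
  choose! e _ he using fun i j (hij : i ≤ j) => ha i j hij ((1 / 2) ^ j) (by positivity)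
  obtain ⟨x, Q, hxS, hQ, heQ, hQx, hxa⟩ := exists_weighted_conj_approx
    (fun k => ha k (k + 1) k.le_succ) (E := fun j => ∑ i ∈ Finset.range (j + 1), ‖e i j‖ ^ 2)
    fun j => by positivity
  choose b hb hba using exists_tendsto_iterConj hQ hQx hxa
  refine ⟨x, b, hxS, fun k => ?_, ?_, ?_⟩
  · exact tendsto_nhds_unique ((tendsto_add_atTop_iff_nat 1).2 (hb k))
      (((continuous_conj (x k)).tendsto _).comp (hb (k + 1)))
  · rintro _ ⟨i, rfl⟩
    have near (j : ℕ) (hij : i ≤ j) : ‖e i j * b j * star (e i j) - a i‖ ≤ 3 * (1 / 2) ^ j := by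
      have norm_sq_le : ‖e i j‖ ^ 2 ≤ Q j :=
        (Finset.single_le_sum (f := fun i => ‖e i j‖ ^ 2) (fun _ _ => by positivity)
          (Finset.mem_range.2 (Nat.lt_succ_of_le hij))).trans (heQ j)
      have conj_near : ‖e i j * (b j - a j) * star (e i j)‖ ≤ 2 * (1 / 2) ^ j :=
        calc _ ≤ ‖e i j‖ ^ 2 * ‖b j - a j‖ := norm_conj_le _ _
          _ ≤ Q j * ‖b j - a j‖ := by gcongr
          _ ≤ 2 * (1 / 2) ^ j := hba j
      rw [conj_sub] at conj_near
      linarith [he i j hij, norm_sub_le_norm_sub_add_norm_sub (e i j * b j * star (e i j))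
        (e i j * a j * star (e i j)) (a i)]
    have vanishing : Tendsto (fun j : ℕ => 3 * (1 / 2 : ℝ) ^ j) atTop (𝓝 0) := by
      simpa using (tendsto_pow_atTop_nhds_zero_of_lt_one (r := (1 / 2 : ℝ)) (by norm_num)
        (by norm_num)).const_mul 3
    exact mem_conjClosure_range_of_tendsto (tendsto_iff_norm_sub_tendsto_zero.2 (squeeze_zero'
      (.of_forall fun _ => norm_nonneg _) (eventually_atTop.2 ⟨i, near⟩) vanishing))
  · rintro _ ⟨j, rfl⟩
    refine mem_closure_of_tendsto ((tendsto_add_atTop_iff_nat 1).2 (hb j)) (.of_forall fun n => ?_)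
    exact ⟨_, ⟨_, rfl⟩, exists_conj_eq_iterConj_succ x a n j⟩

end ExactConjugates

section RowSums

open Filter Topology

section Recursion

variable {R D : Type*} [NonUnitalSemiring D] [SMulZeroClass R D]

/-- The sum over `j < k` of `r_j s_j x_j ⋯ x_{k-1}`. When the `s_j` have orthogonal ranges this is
the row with entries `r_j x_j ⋯ x_{k-1}`. -/
def rowSum (x s : ℕ → D) (r : ℕ → R) : ℕ → D
  | 0 => 0
  | k + 1 => (rowSum x s r k + r k • s k) * x k

variable [StarRing D] [SMulCommClass R D D] {x b s : ℕ → D}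

theorem star_mul_rowSum_eq_zero (hs : ∀ i j, i ≠ j → star (s i) * s j = 0) (r : ℕ → R) {j k : ℕ}
    (hkj : k ≤ j) : star (s j) * rowSum x s r k = 0 := by
  induction k with
  | zero => exact mul_zero _
  | succ k ih =>
    rw [rowSum, ← mul_assoc, mul_add, ih (by lia), mul_smul_comm, hs j k (by lia), smul_zero,
      add_zero, zero_mul]

theorem exists_star_mul_rowSum_eq_smul [IsScalarTower R D D]
    (hb : ∀ k, b k = x k * b (k + 1) * star (x k)) (hsx : ∀ k, star (s k) * s k * x k = x k)
    (hs : ∀ i j, i ≠ j → star (s i) * s j = 0) (r : ℕ → R) (j n : ℕ) :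
    ∃ y, star (s j) * rowSum x s r (n + (j + 1)) = r j • y ∧
      y * b (n + (j + 1)) * star y = b j := by
  induction n with
  | zero =>
    refine ⟨x j, ?_, by rw [zero_add, ← hb]⟩
    rw [zero_add, rowSum, ← mul_assoc, mul_add, star_mul_rowSum_eq_zero hs r le_rfl, zero_add,
      mul_smul_comm, smul_mul_assoc, hsx]
  | succ n ih =>
    obtain ⟨y, hy, hyb⟩ := ih
    refine ⟨y * x (n + (j + 1)), ?_, ?_⟩
    · rw [add_right_comm, rowSum, ← mul_assoc, mul_add, hy, mul_smul_comm, hs j _ (by lia),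
        smul_zero, add_zero, smul_mul_assoc]
    · rw [add_right_comm, ← conj_conj, ← hb, hyb]

end Recursion

variable {D : Type*} [NonUnitalCStarAlgebra D]

theorem exists_ne_zero_norm_conj_add_smul_sub_lt (v s b : D) {ε : ℝ} (hε : 0 < ε) :
    ∃ r : ℂ, r ≠ 0 ∧ ‖(v + r • s) * b * star (v + r • s) - v * b * star v‖ < ε := by
  have hcont : Continuous fun r : ℂ => ‖(v + r • s) * b * star (v + r • s) - v * b * star v‖ := by
    fun_prop
  have hzero : ∀ᶠ r : ℂ in 𝓝[≠] 0,
      ‖(v + r • s) * b * star (v + r • s) - v * b * star v‖ < ε :=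
    nhdsWithin_le_nhds (hcont.tendsto 0 |>.eventually_lt_const (by simpa using hε))
  exact (eventually_mem_nhdsWithin.and hzero).exists

theorem exists_cauchySeq_conj_rowSum {x b : ℕ → D}
    (hb : ∀ k, b k = x k * b (k + 1) * star (x k)) (s : ℕ → D) :
    ∃ r : ℕ → ℂ, (∀ k, r k ≠ 0) ∧
      CauchySeq fun k => rowSum x s r k * b k * star (rowSum x s r k) := by
  choose R hR0 hR using fun k v => exists_ne_zero_norm_conj_add_smul_sub_lt v (s k) (b k)
    (show (0 : ℝ) < (1 / 2) ^ k by positivity)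
  let V : ℕ → D := Nat.rec 0 fun k v => (v + R k v • s k) * x k
  let r (k : ℕ) : ℂ := R k (V k)
  have hV (k : ℕ) : rowSum x s r k = V k := by
    induction k with
    | zero => rfl
    | succ k ih => rw [rowSum, ih]
  refine ⟨r, fun k => hR0 _ _, cauchySeq_of_le_geometric (1 / 2) 1 (by norm_num) fun k => ?_⟩
  rw [dist_comm, dist_eq_norm, one_mul, rowSum, ← conj_conj, ← hb, hV]
  exact (hR k (V k)).le

theorem exists_conj_eq_of_exact_conj_sequence {x b s : ℕ → D}
    (hb : ∀ k, b k = x k * b (k + 1) * star (x k)) (hsx : ∀ k, star (s k) * s k * x k = x k)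
    (hs : ∀ i j, i ≠ j → star (s i) * s j = 0) :
    ∃ c ∈ conjClosure (Set.range b), ∀ j, ∃ d, d * c * star d = b j := by
  obtain ⟨r, hr, hcauchy⟩ := exists_cauchySeq_conj_rowSum hb s
  obtain ⟨c, hc⟩ := cauchySeq_tendsto_of_complete hcauchy
  refine ⟨c, mem_conjClosure_range_of_tendsto hc, fun j => ⟨(r j)⁻¹ • star (s j), ?_⟩⟩
  refine tendsto_nhds_unique (((continuous_conj _).tendsto c).comp
    ((tendsto_add_atTop_iff_nat (j + 1)).2 hc)) (tendsto_const_nhds.congr fun n => ?_)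
  obtain ⟨y, hy, hyb⟩ := exists_star_mul_rowSum_eq_smul hb hsx hs r j n
  change b j = _ * (_ * b _ * star _) * star _
  rw [conj_conj, smul_mul_assoc, hy, inv_smul_smul₀ (hr j), hyb]

end RowSums

section CompactProjections

variable {A : Type u} [CStarAlgebra A]

theorem cuntzLE_iff_mem_conjClosure {a b : Stab A} : CuntzLE a b ↔ a ∈ conjClosure {b} := by
  simp only [CuntzLE, conjClosure, Metric.mem_closure_iff, Set.mem_singleton_iff, exists_eq_left,
    Set.mem_ofPred_eq, exists_exists_eq_and, dist_comm a, dist_eq_norm]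

theorem CuntzLE.exists_of_norm_conj_sub_lt {a b : Stab A} (h : CuntzLE a b) (ε : ℝ) (hε : 0 < ε) :
    ∃ d ∈ Set.range (Stab.of : FinMat A → Stab A), ‖d * b * star d - a‖ < ε := by
  have hopen : IsOpen {d : Stab A | ‖d * b * star d - a‖ < ε} :=
    isOpen_lt (by fun_prop) continuous_const
  obtain ⟨M, hM⟩ := Stab.denseRange_of.exists_mem_open hopen (h ε hε)
  exact ⟨Stab.of M, ⟨M, rfl⟩, hM⟩

theorem FinMat.star_shift_mul_shift_eq_zero {f g : ℕ ↪ ℕ} (hfg : ∀ i j, f i ≠ g j) (m n : ℕ) :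
    star (shift f m) * shift g n = (0 : FinMat A) := by
  obtain ⟨K, hK⟩ := exists_bdd (star (shift f m) : FinMat A)
  ext i j
  rw [mul_apply_left hK]
  refine Finset.sum_eq_zero fun r _ => ?_
  rw [star_apply, shift_apply, shift_apply]
  by_cases h : r = f i ∧ i < m
  · rw [if_neg fun h' : r = g j ∧ j < n => hfg i j (h.1.symm.trans h'.1), mul_zero]
  · rw [if_neg h, star_zero, zero_mul]

/-- The embedding of `ℕ` as the `k`-th row of `ℕ × ℕ ≃ ℕ`. -/
def rowEmb (k : ℕ) : ℕ ↪ ℕ := ⟨Nat.pair k, fun _ _ h => (Nat.pair_eq_pair.1 h).2⟩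

theorem Stab.exists_orthogonal_star_mul_self_mul_eq {x : ℕ → Stab A}
    (hx : ∀ k, x k ∈ Set.range (of : FinMat A → Stab A)) :
    ∃ s : ℕ → Stab A, (∀ k, star (s k) * s k * x k = x k) ∧
      ∀ i j, i ≠ j → star (s i) * s j = 0 := by
  choose M hM using hx
  choose n hn using fun k => FinMat.exists_bdd (M k)
  refine ⟨fun k => of (FinMat.shift (rowEmb k) (n k)), fun k => ?_, fun i j hij => ?_⟩
  · rw [← hM, ← of_star, ← of_mul, ← of_mul, FinMat.star_shift_mul_shift_mul _ (hn k)]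
  · rw [← of_star, ← of_mul, FinMat.star_shift_mul_shift_eq_zero, map_zero]
    exact fun p q h => hij (Nat.pair_eq_pair.1 h).1

theorem exists_upper_bound_mem_conjClosure {a : ℕ → Pos A} (ha : Monotone a) :
    ∃ c : Pos A, (∀ i, a i ≤ c) ∧ c.val ∈ conjClosure (Set.range fun i => (a i).val) := by
  obtain ⟨x, b, hx, hb, hab, hba⟩ := exists_exact_conj_sequence (a := fun i => (a i).val)
    fun i j hij => CuntzLE.exists_of_norm_conj_sub_lt (ha hij)
  obtain ⟨s, hsx, hs⟩ := Stab.exists_orthogonal_star_mul_self_mul_eq hx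
  obtain ⟨c, hcb, hbc⟩ := exists_conj_eq_of_exact_conj_sequence hb hsx hs
  have hca : c ∈ conjClosure (Set.range fun i => (a i).val) := conjClosure_subset hba hcb
  have hc_pos : ∃ d, c = star d * d := exists_eq_star_mul_self_of_mem_conjClosure hca (by
    rintro _ ⟨i, rfl⟩
    exact (a i).pos)
  have range_b_subset : Set.range b ⊆ conjClosure {c} := by
    rintro _ ⟨j, rfl⟩
    exact subset_closure ⟨c, rfl, hbc j⟩
  refine ⟨⟨c, hc_pos⟩, fun i => cuntzLE_iff_mem_conjClosure.2 ?_, hca⟩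
  exact conjClosure_subset range_b_subset (hab ⟨i, rfl⟩)

theorem wayBelow_mk_self_of_isStarProjection {p : Pos A} (hp : IsStarProjection p.val) :
    WayBelow (Cu.mk p) (Cu.mk p) := by
  intro w hw hsup
  obtain ⟨a, rfl⟩ := Cu.mk_surjective.comp_left w
  obtain ⟨c, hac, hca⟩ := exists_upper_bound_mem_conjClosure (a := a) fun i j hij => hw hij
  have hpc : Cu.mk p ≤ Cu.mk c := hsup.2 (by
    rintro _ ⟨i, rfl⟩
    exact hac i)
  have hpa : p.val ∈ conjClosure (Set.range fun i => (a i).val) :=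
    conjClosure_subset (Set.singleton_subset_iff.2 hca) (cuntzLE_iff_mem_conjClosure.1 hpc)
  obtain ⟨_, ⟨_, ⟨i, rfl⟩, d, rfl⟩, hd⟩ :=
    Metric.mem_closure_iff.1 hpa (1 / 2) (by norm_num)
  rw [dist_comm, dist_eq_norm] at hd
  have ha_selfAdjoint : IsSelfAdjoint (a i).val := by
    obtain ⟨e, he⟩ := (a i).pos
    exact he ▸ IsSelfAdjoint.star_mul_self e
  exact ⟨i, cuntzLE_iff_mem_conjClosure.2
    (mem_conjClosure_of_norm_conj_sub_projection_le hp ha_selfAdjoint hd.le)⟩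

variable (A) in
theorem isStarProjection_of_unitMat : IsStarProjection (Stab.of (unitMat A)) := by
  have hstar : star (unitMat A) = unitMat A := by
    rw [unitMat_eq, star_mul, star_star]
  refine ⟨?_, ?_⟩
  · rw [IsIdempotentElem, ← Stab.of_mul]
    nth_rw 1 [← hstar]
    rw [← unitMat_eq]
  · rw [IsSelfAdjoint, ← Stab.of_star, hstar]

variable (A) in
theorem wayBelow_unit_self : WayBelow (Cu.unit A) (Cu.unit A) :=
  wayBelow_mk_self_of_isStarProjection (isStarProjection_of_unitMat A)

end CompactProjections

end CuntzDiv

open CuntzDiv in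
theorem mainTheorem10_general {A : Type u} {B : Type v} [CStarAlgebra A] [CStarAlgebra B] (m n : ℕ)
    {u u' : Cu B} (hu' : WayBelow u' u) :
    (∀ x y : Cu A, n • x ≤ m • y → u.Divisible m n → Cu.tensor x u' ≤ Cu.tensor y u) ∧
    (∀ (x : Fin m → Cu A) (y : Cu A), (∀ j, n • x j ≤ y) → u.Decomposable m n →
      Cu.tensor (∑ j, x j) u' ≤ Cu.tensor y u) ∧
    (∀ (x : Cu A) (y : Fin n → Cu A), (∀ j, x ≤ m • y j) → u.WeaklyDivisible m n →
      Cu.tensor x u' ≤ Cu.tensor (∑ j, y j) u) :=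
  ⟨fun _ _ hxy hu => hu.tensor_le_tensor hu' hxy,
    fun _ _ hxy hu => hu.sum_tensor_le_tensor hu' hxy,
    fun _ _ hxy hu => hu.tensor_le_sum_tensor hu' hxy⟩

open CuntzDiv in
theorem mainTheorem10 {A : Type u} {B : Type v} [CStarAlgebra A] [CStarAlgebra B] (m n : ℕ)
    (hm : 1 ≤ m) (hmn : m < n) :
    (∀ x y : Cu A, n • x ≤ m • y → IsDivisible m n B →
      Cu.tensor x (Cu.unit B) ≤ Cu.tensor y (Cu.unit B)) ∧
    (∀ (x : Fin m → Cu A) (y : Cu A), (∀ j, n • x j ≤ y) → IsDecomposable m n B →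
      Cu.tensor (∑ j, x j) (Cu.unit B) ≤ Cu.tensor y (Cu.unit B)) ∧
    (∀ (x : Cu A) (y : Fin n → Cu A), (∀ j, x ≤ m • y j) → IsWeaklyDivisible m n B →
      Cu.tensor x (Cu.unit B) ≤ Cu.tensor (∑ j, y j) (Cu.unit B)) := by
  exact mainTheorem10_general m n (wayBelow_unit_self B)
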